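/- **Setting.** Let $\mathcal S,\mathcal A$ be finite sets with $S=|\mathcal S|$, $A=|\mathcal A|$, let $H\ge 1$ be the horizon, $s_0\in\mathcal S$ the initial state and $\mathcal D$ a finite set of $d$ resources. The true model consists of unknown transition probabilities $p^\star(\cdot\mid s,a)$, mean rewards $r^\star(s,a)\in[0,1]$ and mean consumptions $\boldsymbol c^\star(s,a)\in[0,1]^{d}$. A policy is $\pi=(\pi_h)_{h=1}^H$ with $\pi_h(\cdot\mid s)$ a distribution on $\mathcal A$. For nonnegative $p(\cdot\mid s,a)$ of total mass at most $1$ and $m:\mathcal S\times\mathcal A\to\mathbb R$ let $\mathbb E^{\pi,p}[\sum_{h=1}^H m(s_h,a_h)]=V^{\pi,p}_m(s_0,1)$, where $V^{\pi,p}_m(s,H+1)=0$ and $V^{\pi,p}_m(s,h)=\sum_a\pi_h(a\mid s)\big(m(s,a)+\sum_{s'}p(s'\mid s,a)V^{\pi,p}_m(s',h+1)\big)$; write $V^{\pi,p}_m$ for $V^{\pi,p}_m(s_0,1)$, and $V^{\pi,p}_{\boldsymbol c}=(V^{\pi,p}_{c_i})_{i\in\mathcal D}$. Let $f:\mathbb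 R\to\mathbb R$ be concave and $g:\mathbb R^d\to\mathbb R$ convex, with $|f(x)-f(y)|\le L|x-y|$ and $|g(x)-g(y)|\le L\|x-y\|_1$. Let $\pi^\star$ maximize $f(V^{\pi,p^\star}_{r^\star})$ over all policies $\pi$ with $g(V^{\pi,p^\star}_{\boldsymbol c^\star})\le 0$ (assumed to exist). **Interaction and algorithm.** Fix $\delta\in(0,1)$. In each episode $k=1,\dots,K$ the learner commits to a policy $\pi_k$ depending on the past episodes (and possibly private randomness), starts in $s_{k,1}=s_0$, and for $h=1,\dots,H$ plays $a_{k,h}\sim\pi_{k,h}(\cdot\mid s_{k,h})$, observes a reward $r_{k,h}\in[0,1]$ and consumptions $c_{k,h,i}\in[0,1]$ with conditional means $r^\star(s_{k,h},a_{k,h})$ and $c^\star_i(s_{k,h},a_{k,h})$ given the past and the current action, and moves to $s_{k,h+1}\sim p^\star(\cdot\mid s_{k,h},a_{k,h})$. Let $N_k(s,a)$ be the maximum of $1$ and the number of visits to $(s,a)$ in episodes $1,\dots,k-1$; let $\widehat p_k(s'\mid s,a)$, $\widehat r_k(s,a)$, $\widehat c_k(s,a,i)$ be, respectively, the number of observed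 transitions from $(s,a)$ to $s'$, the sum of the rewards observed at $(s,a)$ and the sum of the consumptions of resource $i$ observed at $(s,a)$ in those episodes, each divided by $N_k(s,a)$; and let $$\widehat b_k(s,a)=\min\Big\{2H,\ H\sqrt{\tfrac{2\ln(8SAH(d+1)k^2/\delta)}{N_k(s,a)}}\Big\}.$$ The learner chooses $\pi_k$ as a maximizer of the program $$\max_{\pi}\ \max_{|r-\widehat r_k|\le \widehat b_k} f\big(V^{\pi,\widehat p_k}_{r}\big)\quad\text{s.t.}\quad \min_{|c_i-\widehat c_{k,i}|\le\widehat b_k\ \forall i} g\big(V^{\pi,\widehat p_k}_{\boldsymbol c}\big)\le 0$$ (the box constraints hold at every $(s,a)$) whenever this program is feasible, and arbitrarily otherwise. **Theorem.** There is an absolute constant $C>0$ such that, in every such setting, with probability at least $1-\delta$, for all $k=1,\dots,K$ simultaneously, $$f\big(V^{\pi^\star,p^\star}_{r^\star}\big)-f\Big(\frac1k\sum_{t=1}^kV^{\pi_t,p^\star}_{r^\star}\Big)\le L\,B_k,\qquad g\Big(\frac1k\sum_{t=1}^kV^{\pi_t,p^\star}_{\boldsymbol c^\star}\Big)\le L\,d\,B_k,$$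 where $B_k$ is the bound on the reward regret and on the consumption regret in the basic (linear) setting, $$B_k=\frac{C}{\sqrt k}H^{2.5}S\sqrt A\sqrt{\ln(k)\ln\big(SAH(d+1)k/\delta\big)}+\frac Ck S^{3/2}AH^3\sqrt{\ln\big(2SAH(d+1)k/\delta\big)}.$$ -/

import Mathlib

open MeasureTheory

noncomputable section

namespace ConRL

/-- A constrained Markov decision process with state space `S`, action space `A` and set of
resources `D`: transition probabilities, mean rewards and mean resource consumptions. -/
structure CMDP (S A D : Type*) [Fintype S] where
  /-- `p s a s'` is the probability of moving to `s'` after playing `a` in `s` -/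
  p : S → A → S → ℝ
  /-- mean reward -/
  r : S → A → ℝ
  /-- mean consumption of each resource -/
  c : S → A → D → ℝ
  p_nonneg : ∀ s a s', 0 ≤ p s a s'
  p_sum : ∀ s a, ∑ s', p s a s' = 1
  r_mem : ∀ s a, r s a ∈ Set.Icc (0 : ℝ) 1
  c_mem : ∀ s a i, c s a i ∈ Set.Icc (0 : ℝ) 1

/-- `π h s a` is the probability that the (randomized, non-stationary) policy `π` plays `a` in
state `s` at step `h ∈ {1, …, H}`. -/
def IsPolicy {S A : Type*} [Fintype A] (H : ℕ) (π : ℕ → S → A → ℝ) : Prop :=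
  ∀ h ∈ Finset.Icc 1 H, ∀ s, (∀ a, 0 ≤ π h s a) ∧ ∑ a, π h s a = 1

/-- Expected sum of the objective `m` over `n` consecutive steps starting in state `s` at step `h`,
under policy `π` and transitions `p` (dynamic programming). Rows of `p` may have total mass less
than one; the missing mass collects nothing further. -/
def value {S A : Type*} [Fintype S] [Fintype A] (π : ℕ → S → A → ℝ) (p : S → A → S → ℝ)
    (m : S → A → ℝ) : ℕ → ℕ → S → ℝ
  | 0, _, _ => 0
  | n + 1, h, s => ∑ a, π h s a * (m s a + ∑ s', p s a s' * value π p m n (h + 1) s')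

/-- `𝔼^{π,p}[∑_{h=1}^H m(s_h,a_h)]` for the run started at `s₀`. -/
def expTotal {S A : Type*} [Fintype S] [Fintype A] (H : ℕ) (s₀ : S) (π : ℕ → S → A → ℝ)
    (p : S → A → S → ℝ) (m : S → A → ℝ) : ℝ :=
  value π p m H 1 s₀

/-- `𝔼^{π,p}[∑_{h=1}^H c(s_h,a_h)]`, a vector indexed by the resources. -/
def expTotalVec {S A D : Type*} [Fintype S] [Fintype A] (H : ℕ) (s₀ : S) (π : ℕ → S → A → ℝ)
    (p : S → A → S → ℝ) (c : S → A → D → ℝ) : D → ℝ :=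
  fun i => expTotal H s₀ π p (fun s a => c s a i)

/-- What is observed: state, action, reward and consumptions in episode `k ≥ 1` at step `h ≥ 1`. -/
structure Record (S A D : Type*) where
  state : ℕ → ℕ → S
  action : ℕ → ℕ → A
  reward : ℕ → ℕ → ℝ
  cons : ℕ → ℕ → D → ℝ

section Estimates

variable {S A D : Type*} [DecidableEq S] [DecidableEq A]

/-- `N_k(s,a)`: the number of visits to `(s,a)` in episodes `1, …, k-1`, but at least `1`. -/
def visits (H : ℕ) (x : Record S A D) (k : ℕ) (s : S) (a : A) : ℝ :=
  max 1 (∑ t ∈ Finset.Ico 1 k, ∑ h ∈ Finset.Icc 1 H,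
    if x.state t h = s ∧ x.action t h = a then (1 : ℝ) else 0)

/-- Empirical transition frequencies before episode `k`. -/
def pHat (H : ℕ) (x : Record S A D) (k : ℕ) (s : S) (a : A) (s' : S) : ℝ :=
  (1 / visits H x k s a) * ∑ t ∈ Finset.Ico 1 k, ∑ h ∈ Finset.Icc 1 H,
    if x.state t h = s ∧ x.action t h = a ∧ x.state t (h + 1) = s' then (1 : ℝ) else 0

/-- Empirical mean rewards before episode `k`. -/
def rHat (H : ℕ) (x : Record S A D) (k : ℕ) (s : S) (a : A) : ℝ :=
  (1 / visits H x k s a) * ∑ t ∈ Finset.Ico 1 k, ∑ h ∈ Finset.Icc 1 H,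
    if x.state t h = s ∧ x.action t h = a then x.reward t h else 0

/-- Empirical mean consumptions before episode `k`. -/
def cHat (H : ℕ) (x : Record S A D) (k : ℕ) (s : S) (a : A) (i : D) : ℝ :=
  (1 / visits H x k s a) * ∑ t ∈ Finset.Ico 1 k, ∑ h ∈ Finset.Icc 1 H,
    if x.state t h = s ∧ x.action t h = a then x.cons t h i else 0

/-- The exploration bonus of episode `k`, with failure parameter `δ`. -/
def bonus [Fintype S] [Fintype A] [Fintype D] (H : ℕ) (δ : ℝ) (x : Record S A D) (k : ℕ)
    (s : S) (a : A) : ℝ :=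
  min (2 * (H : ℝ))
    ((H : ℝ) * Real.sqrt
      (2 * Real.log (8 * (Fintype.card S : ℝ) * (Fintype.card A : ℝ) * (H : ℝ)
          * ((Fintype.card D : ℝ) + 1) * (k : ℝ) ^ 2 / δ) / visits H x k s a))

end Estimates

section Programs

variable {S A D : Type*} [Fintype S] [Fintype A]

/-- `r ∈ [r̂ ± b]`. -/
def InRewardBox (rh b : S → A → ℝ) (r : S → A → ℝ) : Prop :=
  ∀ s a, r s a ∈ Set.Icc (rh s a - b s a) (rh s a + b s a)

/-- `c ∈ [ĉ ± b · 1]`. -/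
def InConsBox (ch : S → A → D → ℝ) (b : S → A → ℝ) (c : S → A → D → ℝ) : Prop :=
  ∀ s a i, c s a i ∈ Set.Icc (ch s a i - b s a) (ch s a i + b s a)

/-- Feasibility of `π` for the planner: the minimum of `g` over the consumption box is `≤ 0`
(the box is compact, so the minimum of the continuous `g` is attained). -/
def PlannerFeasible (H : ℕ) (s₀ : S) (g : (D → ℝ) → ℝ) (ph : S → A → S → ℝ)
    (ch : S → A → D → ℝ) (b : S → A → ℝ) (π : ℕ → S → A → ℝ) : Prop :=
  IsPolicy H π ∧ ∃ c, InConsBox ch b c ∧ g (expTotalVec H s₀ π ph c) ≤ 0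

/-- `π` solves the concave-convex planning program: it is feasible and, together with some reward
function in the reward box, maximizes the objective over all feasible policies and all reward
functions in the box. -/
def PlannerSolution (H : ℕ) (s₀ : S) (f : ℝ → ℝ) (g : (D → ℝ) → ℝ) (ph : S → A → S → ℝ)
    (rh : S → A → ℝ) (ch : S → A → D → ℝ) (b : S → A → ℝ) (π : ℕ → S → A → ℝ) : Prop :=
  PlannerFeasible H s₀ g ph ch b π ∧
    ∃ r, InRewardBox rh b r ∧
      ∀ π', PlannerFeasible H s₀ g ph ch b π' → ∀ r', InRewardBox rh b r' →
        f (expTotal H s₀ π' ph r') ≤ f (expTotal H s₀ π ph r)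

/-- `π` is an optimal policy of the true concave-convex problem. -/
def IsBenchmark (M : CMDP S A D) (H : ℕ) (s₀ : S) (f : ℝ → ℝ) (g : (D → ℝ) → ℝ)
    (π : ℕ → S → A → ℝ) : Prop :=
  IsPolicy H π ∧ g (expTotalVec H s₀ π M.p M.c) ≤ 0 ∧
    ∀ π', IsPolicy H π' → g (expTotalVec H s₀ π' M.p M.c) ≤ 0 →
      f (expTotal H s₀ π' M.p M.r) ≤ f (expTotal H s₀ π M.p M.r)

/-- Reward regret after `k` episodes in which the policies `π 1, …, π k` were played. -/
def convexRewReg (M : CMDP S A D) (H : ℕ) (s₀ : S) (f : ℝ → ℝ) (πstar : ℕ → S → A → ℝ)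
    (π : ℕ → ℕ → S → A → ℝ) (k : ℕ) : ℝ :=
  f (expTotal H s₀ πstar M.p M.r)
    - f ((1 / (k : ℝ)) * ∑ t ∈ Finset.Icc 1 k, expTotal H s₀ (π t) M.p M.r)

/-- Consumption regret after `k` episodes in which the policies `π 1, …, π k` were played. -/
def convexConsReg (M : CMDP S A D) (H : ℕ) (s₀ : S) (g : (D → ℝ) → ℝ)
    (π : ℕ → ℕ → S → A → ℝ) (k : ℕ) : ℝ :=
  g ((1 / (k : ℝ)) • ∑ t ∈ Finset.Icc 1 k, expTotalVec H s₀ (π t) M.p M.c)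

end Programs

section Interaction

variable {S A D Ω : Type*} [Fintype S] [Fintype A] [DecidableEq S] [DecidableEq A]

/-- The episodic protocol over `K` episodes of horizon `H`. The σ-algebra `past k h` is the
information available just before the action of step `h` in episode `k` (it may contain private
randomness of the learner), and `π k ω` is the policy that the learner commits to at the start of
episode `k`. Rewards and consumptions lie in `[0,1]`; given the past and the current action, their
conditional means, and the law of the next state, are those of the true model `M`. (Rewards and
consumptions drawn afresh from fixed laws with these means, possibly correlated with each other,
are a special case.) -/
structure IsInteraction [MeasurableSpace Ω] (μ : Measure Ω) (M : CMDP S A D) (H K : ℕ) (s₀ : S)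
    (past : ℕ → ℕ → MeasurableSpace Ω) (π : ℕ → Ω → ℕ → S → A → ℝ)
    (X : Ω → Record S A D) : Prop where
  past_le : ∀ k ∈ Finset.Icc 1 K, ∀ h ∈ Finset.Icc 1 (H + 1), past k h ≤ ‹MeasurableSpace Ω›
  past_step : ∀ k ∈ Finset.Icc 1 K, ∀ h ∈ Finset.Icc 1 H, past k h ≤ past k (h + 1)
  past_episode : ∀ k ∈ Finset.Ico 1 K, past k (H + 1) ≤ past (k + 1) 1
  policy : ∀ k ∈ Finset.Icc 1 K, ∀ ω, IsPolicy H (π k ω)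
  policy_meas : ∀ k ∈ Finset.Icc 1 K, ∀ h ∈ Finset.Icc 1 H, ∀ s a,
    Measurable[past k 1] (fun ω => π k ω h s a)
  state_meas : ∀ k ∈ Finset.Icc 1 K, ∀ h ∈ Finset.Icc 1 (H + 1), ∀ s,
    MeasurableSet[past k h] {ω | (X ω).state k h = s}
  action_meas : ∀ k ∈ Finset.Icc 1 K, ∀ h ∈ Finset.Icc 1 H, ∀ a,
    MeasurableSet[past k (h + 1)] {ω | (X ω).action k h = a}
  reward_meas : ∀ k ∈ Finset.Icc 1 K, ∀ h ∈ Finset.Icc 1 H,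
    Measurable[past k (h + 1)] (fun ω => (X ω).reward k h)
  cons_meas : ∀ k ∈ Finset.Icc 1 K, ∀ h ∈ Finset.Icc 1 H, ∀ i,
    Measurable[past k (h + 1)] (fun ω => (X ω).cons k h i)
  init : ∀ k ∈ Finset.Icc 1 K, ∀ ω, (X ω).state k 1 = s₀
  reward_mem : ∀ k ∈ Finset.Icc 1 K, ∀ h ∈ Finset.Icc 1 H,
    ∀ᵐ ω ∂μ, (X ω).reward k h ∈ Set.Icc (0 : ℝ) 1
  cons_mem : ∀ k ∈ Finset.Icc 1 K, ∀ h ∈ Finset.Icc 1 H, ∀ i,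
    ∀ᵐ ω ∂μ, (X ω).cons k h i ∈ Set.Icc (0 : ℝ) 1
  action_law : ∀ k ∈ Finset.Icc 1 K, ∀ h ∈ Finset.Icc 1 H, ∀ a,
    μ[(fun ω => if (X ω).action k h = a then (1 : ℝ) else 0) | past k h]
      =ᵐ[μ] fun ω => π k ω h ((X ω).state k h) a
  next_law : ∀ k ∈ Finset.Icc 1 K, ∀ h ∈ Finset.Icc 1 H, ∀ s',
    μ[(fun ω => if (X ω).state k (h + 1) = s' then (1 : ℝ) else 0) |
        past k h ⊔ MeasurableSpace.comap (fun ω => (X ω).action k h) ⊤]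
      =ᵐ[μ] fun ω => M.p ((X ω).state k h) ((X ω).action k h) s'
  reward_mean : ∀ k ∈ Finset.Icc 1 K, ∀ h ∈ Finset.Icc 1 H,
    μ[(fun ω => (X ω).reward k h) |
        past k h ⊔ MeasurableSpace.comap (fun ω => (X ω).action k h) ⊤]
      =ᵐ[μ] fun ω => M.r ((X ω).state k h) ((X ω).action k h)
  cons_mean : ∀ k ∈ Finset.Icc 1 K, ∀ h ∈ Finset.Icc 1 H, ∀ i,
    μ[(fun ω => (X ω).cons k h i) |
        past k h ⊔ MeasurableSpace.comap (fun ω => (X ω).action k h) ⊤]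
      =ᵐ[μ] fun ω => M.c ((X ω).state k h) ((X ω).action k h) i

/-- The learner runs the algorithm: in every episode, its policy solves the planning program built
from the empirical estimates and the bonus, whenever that program is feasible (an infeasible
program has no solution, and then any policy may be played). -/
def RunsConvexConRL [Fintype D] [MeasurableSpace Ω] (μ : Measure Ω) (H K : ℕ) (s₀ : S) (δ : ℝ)
    (f : ℝ → ℝ) (g : (D → ℝ) → ℝ) (π : ℕ → Ω → ℕ → S → A → ℝ) (X : Ω → Record S A D) : Prop :=
  ∀ k ∈ Finset.Icc 1 K, ∀ᵐ ω ∂μ,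
    (∃ π', PlannerFeasible H s₀ g (pHat H (X ω) k) (cHat H (X ω) k) (bonus H δ (X ω) k) π') →
      PlannerSolution H s₀ f g (pHat H (X ω) k) (rHat H (X ω) k) (cHat H (X ω) k)
        (bonus H δ (X ω) k) (π k ω)

end Interaction

/-- The regret bound of the basic setting after `k` episodes, with constant `C`, for `nS` states,
`nA` actions, horizon `H`, `d` resources and failure parameter `δ`. -/
def basicBound (C : ℝ) (nS nA H d k : ℕ) (δ : ℝ) : ℝ :=
  C / Real.sqrt k * ((H : ℝ) ^ (5 / 2 : ℝ) * (nS : ℝ) * Real.sqrt nA)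
      * Real.sqrt (Real.log k * Real.log ((nS : ℝ) * nA * H * ((d : ℝ) + 1) * k / δ))
    + C / k * ((nS : ℝ) ^ (3 / 2 : ℝ) * nA * (H : ℝ) ^ 3)
      * Real.sqrt (Real.log (2 * (nS : ℝ) * nA * H * ((d : ℝ) + 1) * k / δ))

end ConRL

end

/-! The proof is optimism in the face of uncertainty. On a good event, inflating the empirical model
by the bonus keeps the benchmark attainable for the planner. The simulation lemma bounds the gap
between values under the policy and model `pHat`, `M.objective` and the empirical signals by the
`pHat`-value of the bonus. Since values are affine in the objective, a multiple of the bonus with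
factor in [-1, 1] closes that gap exactly (`exists_box_value_eq`). The benchmark is therefore
planner-feasible with its true objective value, and no monotonicity of f or g is needed. The
planner's choice in episode t then yields v_t with f(v_t) at least the optimum and u_t with g(u_t) ≤
0 (`EstimatesGood.planner`). Jensen and the Lipschitz condition reduce both regrets to the average
over t of the distances from v_t and u_t to the true values of π_t.

These distances are model errors of policies that depend on the data.
`EstimatesGood.abs_expTotal_sub_le` bounds them by the expected total, under the true transitions,
of one-step errors of order H² √(S l / N), where l is the logarithm in the bonus and N the visit
count. This step needs ℓ¹ closeness of the transition rows, because the value functions involved are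
random; for the benchmark's fixed value functions scalar concentration is enough. Expected totals
are replaced by sums along the trajectory up to martingale noise
(`measure_trajectory_deviation_le`), and a pigeonhole argument sums 1/√N (`sum_inv_sqrt_visits_le`).
Clipping the accumulated error at 6H² keeps the noise increments of order H²; unclipped they could
reach order H³ and cost an extra factor H.

All concentration comes from one Azuma–Hoeffding inequality that is uniform in the random number of
active steps (`measure_deviation_le`), so the random visit counts need no stopping times. Episode k
fails with probability at most δ/(k(k+1)), and these sum to at most δ. `average_error_le_basicBound`
compares the outcome with B_k for C = 400. -/

noncomputable section

namespace ConRL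

/-! ### Simulation lemmas for value functions -/

section Value

variable {S A : Type*} [Fintype S] [Fintype A]

/-- Expected total of `e` as in `value`, clipped from above at `R` at every step. -/
def clippedValue (R : ℝ) (π : ℕ → S → A → ℝ) (p : S → A → S → ℝ) (e : S → A → ℝ) :
    ℕ → ℕ → S → ℝ
  | 0, _, _ => 0
  | n + 1, h, s =>
    min R (∑ a, π h s a * (e s a + ∑ s', p s a s' * clippedValue R π p e n (h + 1) s'))

/-- Nonnegative rows of total mass at most one. -/
def IsSubstochastic (p : S → A → S → ℝ) : Prop :=
  (∀ s a s', 0 ≤ p s a s') ∧ ∀ s a, ∑ s', p s a s' ≤ 1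

omit [Fintype A] in
theorem CMDP.isSubstochastic {D : Type*} (M : CMDP S A D) : IsSubstochastic M.p :=
  ⟨M.p_nonneg, fun s a => (M.p_sum s a).le⟩

theorem value_add_mul (π : ℕ → S → A → ℝ) (p : S → A → S → ℝ) (m b : S → A → ℝ) (c : ℝ) :
    ∀ (n h : ℕ) (s : S), value π p (fun s a => m s a + c * b s a) n h s
      = value π p m n h s + c * value π p b n h s
  | 0, h, s => by simp [value]
  | n + 1, h, s => by
    simp only [value, value_add_mul π p m b c n (h + 1), Finset.mul_sum, ← Finset.sum_add_distrib]
    refine Finset.sum_congr rfl fun a _ => ?_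
    have : ∑ s', p s a s' * (value π p m n (h + 1) s' + c * value π p b n (h + 1) s')
        = ∑ s', p s a s' * value π p m n (h + 1) s'
          + c * ∑ s', p s a s' * value π p b n (h + 1) s' := by
      rw [Finset.mul_sum, ← Finset.sum_add_distrib]
      exact Finset.sum_congr rfl fun _ _ => by ring
    rw [this]
    ring

theorem abs_sum_mul_le {ι : Type*} [Fintype ι] {q x y : ι → ℝ} (hq : ∀ i, 0 ≤ q i)
    (h : ∀ i, |x i| ≤ y i) : |∑ i, q i * x i| ≤ ∑ i, q i * y i := by
  refine (Finset.abs_sum_le_sum_abs _ _).trans (Finset.sum_le_sum fun i _ => ?_)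
  rw [abs_mul, abs_of_nonneg (hq i)]
  exact mul_le_mul_of_nonneg_left (h i) (hq i)

theorem sum_mul_le_of_sum_le_one {ι : Type*} [Fintype ι] {q x : ι → ℝ} {B : ℝ} (hB : 0 ≤ B)
    (hq : ∀ i, 0 ≤ q i) (hq1 : ∑ i, q i ≤ 1) (h : ∀ i, x i ≤ B) : ∑ i, q i * x i ≤ B :=
  calc ∑ i, q i * x i ≤ ∑ i, q i * B :=
        Finset.sum_le_sum fun i _ => mul_le_mul_of_nonneg_left (h i) (hq i)
    _ = (∑ i, q i) * B := by rw [Finset.sum_mul]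
    _ ≤ B := mul_le_of_le_one_left hB hq1

theorem abs_sum_mul_le_of_sum_le_one {ι : Type*} [Fintype ι] {q x : ι → ℝ} {B : ℝ} (hB : 0 ≤ B)
    (hq : ∀ i, 0 ≤ q i) (hq1 : ∑ i, q i ≤ 1) (h : ∀ i, |x i| ≤ B) : |∑ i, q i * x i| ≤ B :=
  (abs_sum_mul_le hq h).trans (sum_mul_le_of_sum_le_one hB hq hq1 fun _ => le_rfl)

variable {H : ℕ} {π : ℕ → S → A → ℝ} {p p' : S → A → S → ℝ} {m m' b e : S → A → ℝ}

theorem value_nonneg (hπ : IsPolicy H π) (hp : IsSubstochastic p) (hm : ∀ s a, 0 ≤ m s a) :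
    ∀ (n h : ℕ) (s : S), 1 ≤ h → h + n ≤ H + 1 → 0 ≤ value π p m n h s
  | 0, _, _, _, _ => le_rfl
  | n + 1, h, s, h1, h2 => by
    refine Finset.sum_nonneg fun a _ => mul_nonneg
      ((hπ h (Finset.mem_Icc.2 ⟨h1, by omega⟩) s).1 a) (add_nonneg (hm s a) ?_)
    exact Finset.sum_nonneg fun s' _ => mul_nonneg (hp.1 s a s')
      (value_nonneg hπ hp hm n (h + 1) s' (by omega) (by omega))

theorem abs_value_le {B : ℝ} (hB : 0 ≤ B) (hπ : IsPolicy H π) (hp : IsSubstochastic p)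
    (hm : ∀ s a, |m s a| ≤ B) :
    ∀ (n h : ℕ) (s : S), 1 ≤ h → h + n ≤ H + 1 → |value π p m n h s| ≤ n * B
  | 0, _, _, _, _ => by simp [value]
  | n + 1, h, s, h1, h2 => by
    have hπs := hπ h (Finset.mem_Icc.2 ⟨h1, by omega⟩) s
    have hnB : 0 ≤ (n : ℝ) * B := by positivity
    refine abs_sum_mul_le_of_sum_le_one (by positivity) hπs.1 hπs.2.le fun a => ?_
    have := abs_sum_mul_le_of_sum_le_one hnB (hp.1 s a) (hp.2 s a) fun s' =>
      abs_value_le hB hπ hp hm n (h + 1) s' (by omega) (by omega)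
    calc |m s a + _| ≤ |m s a| + _ := abs_add_le _ _
      _ ≤ B + n * B := add_le_add (hm s a) this
      _ = _ := by push_cast; ring

/-- If the one-step Bellman errors of `p', m'` along the value function of `p, m` are at most `b`,
then the value functions differ by at most the value of `b`. -/
theorem abs_value_sub_value_le (hπ : IsPolicy H π) (hp' : IsSubstochastic p')
    (hb : ∀ n h, 1 ≤ h → h + n = H → ∀ s a,
      |m s a + ∑ s', p s a s' * value π p m n (h + 1) s'
        - (m' s a + ∑ s', p' s a s' * value π p m n (h + 1) s')| ≤ b s a) :
    ∀ (n h : ℕ) (s : S), 1 ≤ h → h + n = H + 1 →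
      |value π p m n h s - value π p' m' n h s| ≤ value π p' b n h s
  | 0, _, _, _, _ => by simp [value]
  | n + 1, h, s, h1, h2 => by
    have hπs := hπ h (Finset.mem_Icc.2 ⟨h1, by omega⟩) s
    simp only [value, ← Finset.sum_sub_distrib, ← mul_sub]
    refine abs_sum_mul_le hπs.1 fun a => ?_
    -- The difference splits into the Bellman error of this step and the `p'`-average of the
    -- difference one step later.
    have ih := abs_sum_mul_le (hp'.1 s a) fun s' =>
      abs_value_sub_value_le hπ hp' hb n (h + 1) s' (by omega) (by omega)
    have hbs := hb n h h1 (by omega) s a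
    simp only [mul_sub, Finset.sum_sub_distrib] at ih
    refine le_trans (le_of_eq ?_) ((abs_add_le _ _).trans (add_le_add hbs ih))
    congr 1
    ring

/-- Bonuses dominating the Bellman errors allow to match a value exactly within the box. -/
theorem exists_box_value_eq (hπ : IsPolicy H π) (hp' : IsSubstochastic p')
    (hb0 : ∀ s a, 0 ≤ b s a)
    (hb : ∀ n h, 1 ≤ h → h + n = H → ∀ s a,
      |m s a + ∑ s', p s a s' * value π p m n (h + 1) s'
        - (m' s a + ∑ s', p' s a s' * value π p m n (h + 1) s')| ≤ b s a) (s₀ : S) :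
    ∃ r, InRewardBox m' b r ∧ expTotal H s₀ π p' r = expTotal H s₀ π p m := by
  have key := abs_value_sub_value_le hπ hp' hb H 1 s₀ le_rfl (by omega)
  set v := value π p m H 1 s₀
  set v' := value π p' m' H 1 s₀
  set w := value π p' b H 1 s₀
  have hw : 0 ≤ w := (abs_nonneg _).trans key
  -- The value of `m' + α b` is `v' + α w`, so `α` solves a linear equation; if `w = 0` the two
  -- values already agree.
  obtain ⟨α, hα, hαw⟩ : ∃ α : ℝ, |α| ≤ 1 ∧ α * w = v - v' := by
    rcases hw.eq_or_lt with h0 | h0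
    · refine ⟨0, by simp, ?_⟩
      rw [← h0] at key
      rw [abs_nonpos_iff.1 key, zero_mul]
    · refine ⟨(v - v') / w, ?_, div_mul_cancel₀ _ h0.ne'⟩
      rw [abs_div, abs_of_pos h0]
      exact div_le_one_of_le₀ key hw
  refine ⟨fun s a => m' s a + α * b s a, fun s a => ?_, ?_⟩
  · have := abs_le.1 hα
    constructor <;> nlinarith [hb0 s a]
  · rw [expTotal, value_add_mul]
    change v' + α * w = v
    rw [hαw]; ring

theorem clippedValue_mem {R : ℝ} (hR : 0 ≤ R) (hπ : IsPolicy H π) (hp : IsSubstochastic p)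
    (he : ∀ s a, 0 ≤ e s a) :
    ∀ (n h : ℕ) (s : S), 1 ≤ h → h + n ≤ H + 1 → clippedValue R π p e n h s ∈ Set.Icc 0 R
  | 0, _, _, _, _ => ⟨le_rfl, hR⟩
  | n + 1, h, s, h1, h2 => by
    refine ⟨le_min hR (Finset.sum_nonneg fun a _ => mul_nonneg
      ((hπ h (Finset.mem_Icc.2 ⟨h1, by omega⟩) s).1 a) (add_nonneg (he s a) ?_)), min_le_left _ _⟩
    exact Finset.sum_nonneg fun s' _ => mul_nonneg (hp.1 s a s')
      (clippedValue_mem hR hπ hp he n (h + 1) s' (by omega) (by omega)).1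

/-- Simulation lemma with clipping. -/
theorem abs_value_sub_value_le_clippedValue {R : ℝ} (hπ : IsPolicy H π) (hp : IsSubstochastic p)
    (hR : ∀ n h s, 1 ≤ h → h + n = H + 1 → |value π p' m' n h s - value π p m n h s| ≤ R)
    (he : ∀ n h, 1 ≤ h → h + n = H → ∀ s a,
      |m' s a + ∑ s', p' s a s' * value π p' m' n (h + 1) s'
        - (m s a + ∑ s', p s a s' * value π p' m' n (h + 1) s')| ≤ e s a) :
    ∀ (n h : ℕ) (s : S), 1 ≤ h → h + n = H + 1 →
      |value π p' m' n h s - value π p m n h s| ≤ clippedValue R π p e n h s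
  | 0, _, _, _, _ => by simp [value, clippedValue]
  | n + 1, h, s, h1, h2 => by
    refine le_min (hR _ _ _ h1 h2) ?_
    have hπs := hπ h (Finset.mem_Icc.2 ⟨h1, by omega⟩) s
    simp only [value, ← Finset.sum_sub_distrib, ← mul_sub]
    refine abs_sum_mul_le hπs.1 fun a => ?_
    have ih := abs_sum_mul_le (hp.1 s a) fun s' =>
      abs_value_sub_value_le_clippedValue hπ hp hR he n (h + 1) s' (by omega) (by omega)
    have hbs := he n h h1 (by omega) s a
    simp only [mul_sub, Finset.sum_sub_distrib] at ih
    refine le_trans (le_of_eq ?_) ((abs_add_le _ _).trans (add_le_add hbs ih))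
    congr 1
    ring

end Value

/-! ### Visit counts and the pigeonhole bound -/

section Counting

/-- One episode with `v ≤ H` visits, after `n` earlier ones, pays at most the potential gain. -/
theorem div_sqrt_max_le_potential {n v H : ℝ} (hn : 0 ≤ n) (hv : 0 ≤ v) (hvH : v ≤ H) :
    v / √(max 1 n) ≤ (2 * √2 * √(n + v) + min (n + v) (2 * H))
      - (2 * √2 * √n + min n (2 * H)) := by
  have hs : √n ≤ √(n + v) := Real.sqrt_le_sqrt (by linarith)
  -- Counts are frozen during an episode, so up to H visits may be charged at a stale count. While
  -- `n < H` the linear part of the potential grows by exactly `v`, since `n + v ≤ 2H`. Afterwards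
  -- `v ≤ n`, so the count at most doubles and the square root part pays.
  rcases lt_or_ge n H with h | h
  · rw [min_eq_left (by linarith), min_eq_left (by linarith)]
    have h1 : v / √(max 1 n) ≤ v :=
      div_le_self hv (Real.one_le_sqrt.2 (le_max_left _ _))
    have h2 : 0 ≤ √2 * (√(n + v) - √n) := mul_nonneg (by positivity) (by linarith)
    nlinarith
  · have hm : min n (2 * H) ≤ min (n + v) (2 * H) := min_le_min_right _ (by linarith)
    have hmain : v / √(max 1 n) ≤ 2 * √2 * (√(n + v) - √n) := by
      rcases hn.eq_or_lt with h0 | h0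
      · have : v = 0 := by linarith
        simp [this]
      have hn0 : 0 < √n := Real.sqrt_pos.2 h0
      have h1 : v / √(max 1 n) ≤ v / √n :=
        div_le_div_of_nonneg_left hv hn0 (Real.sqrt_le_sqrt (le_max_right _ _))
      refine h1.trans ?_
      rw [div_le_iff₀ hn0]
      have e1 : √(n + v) ^ 2 = n + v := Real.sq_sqrt (by linarith)
      have e2 : √n ^ 2 = n := Real.sq_sqrt hn
      have e3 : √(n + v) ≤ √2 * √n := by
        rw [← Real.sqrt_mul (by norm_num)]
        exact Real.sqrt_le_sqrt (by linarith)
      have e4 : (1 : ℝ) ≤ √2 := Real.one_le_sqrt.2 (by norm_num)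
      have e5 : √(n + v) + √n ≤ 2 * √2 * √n := by nlinarith
      have e6 : v = (√(n + v) - √n) * (√(n + v) + √n) := by nlinarith
      have := mul_le_mul_of_nonneg_left e5 (sub_nonneg.2 hs)
      nlinarith
    linarith

variable {S A D : Type*} [DecidableEq S] [DecidableEq A]

/-- The number of visits to `(s, a)` in episodes `1, …, k - 1`. -/
def visitCount (H : ℕ) (x : Record S A D) (k : ℕ) (s : S) (a : A) : ℝ :=
  ∑ t ∈ Finset.Ico 1 k, ∑ h ∈ Finset.Icc 1 H,
    if x.state t h = s ∧ x.action t h = a then (1 : ℝ) else 0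

theorem visits_eq (H : ℕ) (x : Record S A D) (k : ℕ) (s : S) (a : A) :
    visits H x k s a = max 1 (visitCount H x k s a) := rfl

theorem visitCount_nonneg (H : ℕ) (x : Record S A D) (k : ℕ) (s : S) (a : A) :
    0 ≤ visitCount H x k s a :=
  Finset.sum_nonneg fun _ _ => Finset.sum_nonneg fun _ _ => by split_ifs <;> simp

theorem one_le_visits (H : ℕ) (x : Record S A D) (k : ℕ) (s : S) (a : A) :
    1 ≤ visits H x k s a := le_max_left _ _

/-- The count is an integer, so being positive makes it at least 1 and the truncation in `visits`
inactive. -/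
theorem visits_eq_of_pos {H : ℕ} {x : Record S A D} {k : ℕ} {s : S} {a : A}
    (h : 0 < visitCount H x k s a) : visits H x k s a = visitCount H x k s a := by
  rw [visits_eq]
  refine max_eq_right ?_
  have : visitCount H x k s a = ((∑ t ∈ Finset.Ico 1 k, ∑ h ∈ Finset.Icc 1 H,
      if x.state t h = s ∧ x.action t h = a then 1 else 0 : ℕ) : ℝ) := by
    simp [visitCount]
  rw [this] at h ⊢
  exact_mod_cast h

/-- The potential gains of `div_sqrt_max_le_potential` telescope over the episodes. -/
theorem sum_visits_div_sqrt_le (H : ℕ) (x : Record S A D) (s : S) (a : A) (k : ℕ) :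
    ∑ t ∈ Finset.Ico 1 (k + 1), (∑ h ∈ Finset.Icc 1 H,
      if x.state t h = s ∧ x.action t h = a then (1 : ℝ) else 0) / √(visits H x t s a)
      ≤ 2 * √2 * √(visitCount H x (k + 1) s a) + min (visitCount H x (k + 1) s a) (2 * H) := by
  induction k with
  | zero => simp [visitCount]
  | succ k ih =>
    have hc : visitCount H x (k + 1 + 1) s a = visitCount H x (k + 1) s a
        + ∑ h ∈ Finset.Icc 1 H,
          if x.state (k + 1) h = s ∧ x.action (k + 1) h = a then (1 : ℝ) else 0 :=
      Finset.sum_Ico_succ_top (by omega) _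
    rw [Finset.sum_Ico_succ_top (by omega), hc]
    have hv : ∑ h ∈ Finset.Icc 1 H,
        (if x.state (k + 1) h = s ∧ x.action (k + 1) h = a then (1 : ℝ) else 0) ≤ H := by
      calc _ ≤ ∑ h ∈ Finset.Icc 1 H, (1 : ℝ) :=
            Finset.sum_le_sum fun _ _ => by split_ifs <;> simp
        _ = H := by simp
    have := div_sqrt_max_le_potential (visitCount_nonneg H x (k + 1) s a)
      (Finset.sum_nonneg fun _ _ => by split_ifs <;> simp) hv
    rw [← visits_eq] at this
    linarith

theorem sum_visitCount [Fintype S] [Fintype A] (H : ℕ) (x : Record S A D) (k : ℕ) :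
    ∑ s, ∑ a, visitCount H x (k + 1) s a = k * H := by
  have h1 : ∀ t h, ∑ s, ∑ a,
      (if x.state t h = s ∧ x.action t h = a then (1 : ℝ) else 0) = 1 := by
    intro t h
    simp [ite_and]
  simp only [visitCount]
  calc _ = ∑ t ∈ Finset.Ico 1 (k + 1), ∑ h ∈ Finset.Icc 1 H, ∑ s, ∑ a,
        (if x.state t h = s ∧ x.action t h = a then (1 : ℝ) else 0) := by
        simp_rw [Finset.sum_comm (s := (Finset.univ : Finset A)),
          Finset.sum_comm (s := (Finset.univ : Finset S))]
    _ = k * H := by simp only [h1]; simp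

/-- Pigeonhole bound on the inverse square roots of the visit counts along the trajectory. -/
theorem sum_inv_sqrt_visits_le [Fintype S] [Fintype A] (H : ℕ) (x : Record S A D) (k : ℕ) :
    ∑ t ∈ Finset.Ico 1 (k + 1), ∑ h ∈ Finset.Icc 1 H,
      1 / √(visits H x t (x.state t h) (x.action t h))
      ≤ 2 * √2 * √(Fintype.card S * Fintype.card A * (k * H))
        + 2 * H * (Fintype.card S * Fintype.card A) := by
  have h1 : ∀ t h, 1 / √(visits H x t (x.state t h) (x.action t h)) = ∑ q : S × A,
      (if x.state t h = q.1 ∧ x.action t h = q.2 then (1 : ℝ) else 0) / √(visits H x t q.1 q.2) := by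
    intro t h
    rw [Fintype.sum_prod_type]
    simp [ite_and, ite_div]
  have h2 : ∑ t ∈ Finset.Ico 1 (k + 1), ∑ h ∈ Finset.Icc 1 H,
      1 / √(visits H x t (x.state t h) (x.action t h))
      = ∑ q : S × A, ∑ t ∈ Finset.Ico 1 (k + 1), (∑ h ∈ Finset.Icc 1 H,
      if x.state t h = q.1 ∧ x.action t h = q.2 then (1 : ℝ) else 0) / √(visits H x t q.1 q.2) := by
    conv_rhs => rw [Finset.sum_comm]
    refine Finset.sum_congr rfl fun t _ => ?_
    simp only [h1, Finset.sum_div]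
    exact Finset.sum_comm
  -- Cauchy–Schwarz over the state-action pairs, whose counts add up to `k * H`.
  have h3 : (∑ q : S × A, √(visitCount H x (k + 1) q.1 q.2))
      ≤ √(Fintype.card S * Fintype.card A * (k * H)) := by
    refine Real.le_sqrt_of_sq_le ?_
    refine (sq_sum_le_card_mul_sum_sq (s := (Finset.univ : Finset (S × A)))
      (f := fun q => √(visitCount H x (k + 1) q.1 q.2))).trans (le_of_eq ?_)
    rw [Finset.card_univ, Fintype.card_prod, ← sum_visitCount H x k]
    push_cast
    rw [← Fintype.sum_prod_type (f := fun q : S × A => visitCount H x (k + 1) q.1 q.2)]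
    congr 1
    exact Finset.sum_congr rfl fun q _ => Real.sq_sqrt (visitCount_nonneg H x _ _ _)
  rw [h2]
  calc _ ≤ ∑ q : S × A, (2 * √2 * √(visitCount H x (k + 1) q.1 q.2) + 2 * H) :=
        Finset.sum_le_sum fun q _ => (sum_visits_div_sqrt_le H x q.1 q.2 k).trans
          (add_le_add_right (min_le_right _ _) _)
    _ = 2 * √2 * ∑ q : S × A, √(visitCount H x (k + 1) q.1 q.2)
        + 2 * H * (Fintype.card S * Fintype.card A) := by
        rw [Finset.sum_add_distrib, ← Finset.mul_sum]
        simp [Fintype.card_prod]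
        ring
    _ ≤ _ := by gcongr

end Counting

/-! ### Azuma–Hoeffding with a random number of active steps -/

section Concentration

/-- Hoeffding's lemma for a two-point distribution. -/
theorem two_point_hoeffding {q : ℝ} (h0 : 0 ≤ q) (h1 : q ≤ 1) (u : ℝ) :
    1 + q * (Real.exp u - 1) ≤ Real.exp (q * u + u ^ 2 / 8) := by
  -- The Bernoulli law of mean `q`; its centred moment generating function is at most exp(u²/8), and
  -- multiplying by exp(q u) removes the centring.
  let ν : Measure ℝ :=
    ENNReal.ofReal (1 - q) • Measure.dirac 0 + ENNReal.ofReal q • Measure.dirac 1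
  have hν : IsProbabilityMeasure ν := ⟨by
    simp only [ν, Measure.coe_add, Measure.coe_smul, Pi.add_apply, Pi.smul_apply, measure_univ,
      smul_eq_mul, mul_one]
    rw [← ENNReal.ofReal_add (by linarith) h0]
    simp⟩
  have hint : ∀ F : ℝ → ℝ, ∫ x, F x ∂ν = (1 - q) * F 0 + q * F 1 := by
    intro F
    have hd : ∀ (c x : ℝ), Integrable F (ENNReal.ofReal c • Measure.dirac x) := fun c x =>
      (integrable_dirac (by simp)).smul_measure ENNReal.ofReal_ne_top
    rw [integral_add_measure (hd _ _) (hd _ _), integral_smul_measure, integral_smul_measure,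
      integral_dirac, integral_dirac, ENNReal.toReal_ofReal (by linarith),
      ENNReal.toReal_ofReal h0]
    rfl
  have hmem : ∀ᵐ x ∂ν, (fun x : ℝ => x) x ∈ Set.Icc (0 : ℝ) 1 := by
    rw [ae_add_measure_iff]
    constructor <;> refine Measure.ae_smul_measure ?_ _ <;> rw [ae_dirac_eq] <;> simp
  have key := (ProbabilityTheory.hasSubgaussianMGF_of_mem_Icc
    (aemeasurable_id (μ := ν)) hmem).mgf_le u
  have hmean : ∫ x, id x ∂ν = q := by rw [hint]; simp
  rw [hmean, ProbabilityTheory.mgf, hint] at key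
  have hc : ((((‖(1 : ℝ) - 0‖₊ / 2) ^ 2 : NNReal)) : ℝ) * u ^ 2 / 2 = u ^ 2 / 8 := by
    simp; ring
  rw [hc] at key
  simp only [id_eq, zero_sub] at key
  have e1 : Real.exp (u * -q) = Real.exp (-(q * u)) := by ring_nf
  have e2 : Real.exp (u * (1 - q)) = Real.exp (-(q * u)) * Real.exp u := by
    rw [← Real.exp_add]; ring_nf
  rw [e1, e2] at key
  have e3 : Real.exp (q * u) * Real.exp (-(q * u)) = 1 := by
    rw [← Real.exp_add]; simp
  rw [Real.exp_add]
  calc 1 + q * (Real.exp u - 1)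
      = Real.exp (q * u) * Real.exp (-(q * u)) * (1 + q * (Real.exp u - 1)) := by rw [e3, one_mul]
    _ = Real.exp (q * u) * ((1 - q) * Real.exp (-(q * u))
          + q * (Real.exp (-(q * u)) * Real.exp u)) := by ring
    _ ≤ _ := mul_le_mul_of_nonneg_left key (Real.exp_pos _).le

/-- By convexity of exp. The bound is affine in `z`, so conditioning can replace `z` by its
conditional mean, after which `two_point_hoeffding` applies pointwise. -/
theorem exp_mul_le_chord {B z : ℝ} (hB : 0 < B) (hz : z ∈ Set.Icc 0 B) (l : ℝ) :
    Real.exp (l * z) ≤ 1 + z / B * (Real.exp (l * B) - 1) := by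
  have h0 : 0 ≤ z / B := div_nonneg hz.1 hB.le
  have h1 : z / B ≤ 1 := (div_le_one hB).2 hz.2
  have := convexOn_exp.2 (Set.mem_univ 0) (Set.mem_univ (l * B)) (sub_nonneg.2 h1) h0 (by ring)
  simp only [smul_eq_mul, mul_zero, zero_add, Real.exp_zero, mul_one] at this
  have e : z / B * (l * B) = l * z := by field_simp
  rw [e] at this
  linarith

variable {Ω : Type*} {m m0 : MeasurableSpace Ω} {μ : Measure Ω} [IsProbabilityMeasure μ]

theorem condExp_mem_Icc (hm : m ≤ m0) {Z q : Ω → ℝ} {B : ℝ} (hZm : AEStronglyMeasurable Z μ)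
    (hZ : ∀ᵐ ω ∂μ, Z ω ∈ Set.Icc 0 B) (hq : μ[Z | m] =ᵐ[μ] q) :
    ∀ᵐ ω ∂μ, q ω ∈ Set.Icc 0 B := by
  have hZi : Integrable Z μ := Integrable.of_bound hZm B (by
    filter_upwards [hZ] with ω h
    rw [Real.norm_eq_abs, abs_of_nonneg h.1]
    exact h.2)
  have h1 := condExp_mono (m := m) (integrable_const (0 : ℝ)) hZi (hZ.mono fun ω h => h.1)
  have h2 := condExp_mono (m := m) hZi (integrable_const B) (hZ.mono fun ω h => h.2)
  rw [condExp_const hm] at h1 h2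
  filter_upwards [h1, h2, hq] with ω a b c
  rw [c] at a b
  exact ⟨a, b⟩

/-- One step of the exponential supermartingale: `w` is the indicator of an active step. -/
theorem integral_mul_exp_le (hm : m ≤ m0) {P Z q w : Ω → ℝ} {B C : ℝ} (hB : 0 < B)
    (hPm : AEStronglyMeasurable[m] P μ) (hP : ∀ᵐ ω ∂μ, P ω ∈ Set.Icc 0 C)
    (hZm : AEStronglyMeasurable Z μ) (hZ : ∀ᵐ ω ∂μ, Z ω ∈ Set.Icc 0 B)
    (hq : μ[Z | m] =ᵐ[μ] q)
    (hwm : AEStronglyMeasurable[m] w μ) (hw : ∀ᵐ ω ∂μ, w ω = 1 ∨ (w ω = 0 ∧ q ω = 0)) (l : ℝ) :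
    ∫ ω, P ω * Real.exp (l * (Z ω - q ω) - w ω * (l ^ 2 * B ^ 2 / 8)) ∂μ ≤ ∫ ω, P ω ∂μ := by
  have hqB := condExp_mem_Icc hm hZm hZ hq
  have hqm : AEStronglyMeasurable[m] q μ :=
    (stronglyMeasurable_condExp (m := m) (μ := μ) (f := Z)).aestronglyMeasurable.congr hq
  -- All factors known to `m`; only `exp (l * Z)` is left out, and the chord makes it affine in `Z`.
  set P' : Ω → ℝ := fun ω => P ω * Real.exp (-l * q ω - w ω * (l ^ 2 * B ^ 2 / 8)) with hP'
  have hP'm : AEStronglyMeasurable[m] P' μ :=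
    hPm.mul (Real.continuous_exp.comp_aestronglyMeasurable
      ((hqm.const_mul (-l)).sub (hwm.mul_const _)))
  have hP'b : ∀ᵐ ω ∂μ, P' ω ∈ Set.Icc 0 (C * Real.exp (|l| * B)) := by
    filter_upwards [hP, hqB, hw] with ω h1 h2 h3
    have hw0 : 0 ≤ w ω * (l ^ 2 * B ^ 2 / 8) := by
      rcases h3 with h | h
      · rw [h]; positivity
      · rw [h.1, zero_mul]
    refine ⟨mul_nonneg h1.1 (Real.exp_pos _).le, mul_le_mul h1.2 (Real.exp_le_exp.2 ?_)
      (Real.exp_pos _).le (h1.1.trans h1.2)⟩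
    have : -l * q ω ≤ |l| * B :=
      calc -l * q ω ≤ |-l * q ω| := le_abs_self _
        _ = |l| * q ω := by rw [abs_mul, abs_neg, abs_of_nonneg h2.1]
        _ ≤ _ := mul_le_mul_of_nonneg_left h2.2 (abs_nonneg _)
    linarith
  have hZi : Integrable Z μ := Integrable.of_bound hZm B (by
    filter_upwards [hZ] with ω h
    rw [Real.norm_eq_abs, abs_of_nonneg h.1]
    exact h.2)
  have hP'i : Integrable P' μ := Integrable.of_bound (hP'm.mono hm) _ (by
    filter_upwards [hP'b] with ω h
    rw [Real.norm_eq_abs, abs_of_nonneg h.1]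
    exact h.2)
  have hP'Z : Integrable (P' * Z) μ := hZi.bdd_mul (hP'm.mono hm) (by
    filter_upwards [hP'b] with ω h
    rw [Real.norm_eq_abs, abs_of_nonneg h.1]
    exact h.2)
  have hpull : ∫ ω, P' ω * Z ω ∂μ = ∫ ω, P' ω * q ω ∂μ := by
    have h1 := condExp_mul_of_aestronglyMeasurable_left hP'm hP'Z hZi
    calc ∫ ω, (P' * Z) ω ∂μ = ∫ ω, (μ[P' * Z | m]) ω ∂μ := (integral_condExp hm).symm
      _ = _ := integral_congr_ae (by
        filter_upwards [h1, hq] with ω a b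
        rw [a, Pi.mul_apply, b])
  have hqi : Integrable q μ := (integrable_condExp (m := m) (f := Z)).congr hq
  have hP'q : Integrable (fun ω => P' ω * q ω) μ := hqi.bdd_mul (hP'm.mono hm) (by
    filter_upwards [hP'b] with ω h
    rw [Real.norm_eq_abs, abs_of_nonneg h.1]
    exact h.2)
  have hPi : Integrable P μ := Integrable.of_bound (hPm.mono hm) C (by
    filter_upwards [hP] with ω h
    rw [Real.norm_eq_abs, abs_of_nonneg h.1]
    exact h.2)
  set κ : ℝ := (Real.exp (l * B) - 1) / B with hκ
  calc ∫ ω, P ω * Real.exp (l * (Z ω - q ω) - w ω * (l ^ 2 * B ^ 2 / 8)) ∂μ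
      ≤ ∫ ω, (P' ω + κ * (P' ω * Z ω)) ∂μ := by
        refine integral_mono_of_nonneg ?_ (hP'i.add (hP'Z.const_mul κ)) ?_
        · filter_upwards [hP] with ω h
          exact mul_nonneg h.1 (Real.exp_pos _).le
        · filter_upwards [hP'b, hZ] with ω h1 h2
          have e : P ω * Real.exp (l * (Z ω - q ω) - w ω * (l ^ 2 * B ^ 2 / 8))
              = P' ω * Real.exp (l * Z ω) := by
            rw [hP', mul_assoc, ← Real.exp_add]
            ring_nf
          rw [e]
          refine (mul_le_mul_of_nonneg_left (exp_mul_le_chord hB h2 l) h1.1).trans (le_of_eq ?_)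
          rw [hκ]; ring
    _ = ∫ ω, (P' ω + κ * (P' ω * q ω)) ∂μ := by
        have h1 : ∫ ω, (P' ω + κ * (P' ω * Z ω)) ∂μ
            = ∫ ω, P' ω ∂μ + ∫ ω, κ * (P' ω * Z ω) ∂μ := integral_add hP'i (hP'Z.const_mul κ)
        rw [h1, integral_add hP'i (hP'q.const_mul κ), integral_const_mul, integral_const_mul,
          hpull]
    _ ≤ ∫ ω, P ω ∂μ := by
        refine integral_mono_ae (hP'i.add (hP'q.const_mul κ)) hPi ?_
        filter_upwards [hP, hqB, hw] with ω h1 h2 h3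
        have e : P' ω + κ * (P' ω * q ω) = P ω * (Real.exp (-l * q ω - w ω * (l ^ 2 * B ^ 2 / 8))
            * (1 + q ω / B * (Real.exp (l * B) - 1))) := by
          simp only [hP', hκ]; ring
        rw [e]
        refine mul_le_of_le_one_right h1.1 ?_
        -- On an active step the compensator cancels the Hoeffding exponent. On an inactive one both
        -- `w` and `q` vanish and the factor is 1.
        rcases h3 with h | h
        · have := two_point_hoeffding (div_nonneg h2.1 hB.le) ((div_le_one hB).2 h2.2) (l * B)
          refine (mul_le_mul_of_nonneg_left this (Real.exp_pos _).le).trans (le_of_eq ?_)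
          rw [← Real.exp_add, h, Real.exp_eq_one_iff]
          field_simp
          ring
        · rw [h.1, h.2]; simp

/-- Exponential supermartingale inequality for bounded increments with active-step indicators. -/
theorem integral_exp_sum_le_one {F : ℕ → MeasurableSpace Ω} {n : ℕ} {Z q w : ℕ → Ω → ℝ} {B : ℝ}
    (hB : 0 < B) (hF : ∀ i < n, F i ≤ m0) (hmono : ∀ i, i + 1 < n → F i ≤ F (i + 1))
    (hZm : ∀ i < n, AEStronglyMeasurable (Z i) μ)
    (hZF : ∀ i, i + 1 < n → AEStronglyMeasurable[F (i + 1)] (Z i) μ)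
    (hZ : ∀ i < n, ∀ᵐ ω ∂μ, Z i ω ∈ Set.Icc 0 B)
    (hq : ∀ i < n, μ[Z i | F i] =ᵐ[μ] q i)
    (hwm : ∀ i < n, AEStronglyMeasurable[F i] (w i) μ)
    (hw : ∀ i < n, ∀ᵐ ω ∂μ, w i ω = 1 ∨ (w i ω = 0 ∧ q i ω = 0)) (l : ℝ) :
    Integrable (fun ω => Real.exp (∑ i ∈ Finset.range n,
        (l * (Z i ω - q i ω) - w i ω * (l ^ 2 * B ^ 2 / 8)))) μ ∧
      ∫ ω, Real.exp (∑ i ∈ Finset.range n,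
        (l * (Z i ω - q i ω) - w i ω * (l ^ 2 * B ^ 2 / 8))) ∂μ ≤ 1 := by
  set D : ℕ → Ω → ℝ := fun i ω => l * (Z i ω - q i ω) - w i ω * (l ^ 2 * B ^ 2 / 8) with hD
  have hqm : ∀ i < n, AEStronglyMeasurable[F i] (q i) μ := fun i hi =>
    (stronglyMeasurable_condExp (m := F i) (μ := μ) (f := Z i)).aestronglyMeasurable.congr (hq i hi)
  have hDb : ∀ i < n, ∀ᵐ ω ∂μ, D i ω ≤ |l| * B := by
    intro i hi
    filter_upwards [hZ i hi, condExp_mem_Icc (hF i hi) (hZm i hi) (hZ i hi) (hq i hi), hw i hi]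
      with ω h1 h2 h3
    have hw0 : 0 ≤ w i ω * (l ^ 2 * B ^ 2 / 8) := by
      rcases h3 with h | h
      · rw [h]; positivity
      · rw [h.1, zero_mul]
    have : l * (Z i ω - q i ω) ≤ |l| * B := by
      refine (le_abs_self _).trans ?_
      rw [abs_mul]
      refine mul_le_mul_of_nonneg_left (abs_le.2 ⟨?_, ?_⟩) (abs_nonneg _) <;>
        linarith [h1.1, h1.2, h2.1, h2.2]
    simp only [hD]
    linarith
  have hDm : ∀ i < n, AEStronglyMeasurable (D i) μ := fun i hi =>
    (((hZm i hi).sub ((hqm i hi).mono (hF i hi))).const_mul l).sub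
      (((hwm i hi).mono (hF i hi)).mul_const _)
  have hDF : ∀ i, i + 1 < n → AEStronglyMeasurable[F (i + 1)] (D i) μ := fun i hi =>
    (((hZF i hi).sub ((hqm i (by omega)).mono (hmono i hi))).const_mul l).sub
      (((hwm i (by omega)).mono (hmono i hi)).mul_const _)
  -- The one-step lemma requires an adapted and bounded prefactor, so both properties travel with
  -- the induction. Adaptedness stops before `n`, where no σ-algebra is prescribed.
  have main : ∀ j ≤ n,
      AEStronglyMeasurable (fun ω => ∑ i ∈ Finset.range j, D i ω) μ ∧
      (j < n → AEStronglyMeasurable[F j] (fun ω => ∑ i ∈ Finset.range j, D i ω) μ) ∧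
      (∀ᵐ ω ∂μ, ∑ i ∈ Finset.range j, D i ω ≤ j * (|l| * B)) ∧
      ∫ ω, Real.exp (∑ i ∈ Finset.range j, D i ω) ∂μ ≤ 1 := by
    intro j
    induction j with
    | zero =>
      intro _
      simp only [Finset.range_zero, Finset.sum_empty, Real.exp_zero]
      exact ⟨aestronglyMeasurable_const, fun _ => aestronglyMeasurable_const, by simp, by simp⟩
    | succ j ih =>
      intro hj
      obtain ⟨h1, h2, h3, h4⟩ := ih (by omega)
      simp only [Finset.sum_range_succ]
      refine ⟨h1.add (hDm j (by omega)),
        fun hj' => ((h2 (by omega)).mono (hmono j hj')).add (hDF j hj'), ?_, ?_⟩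
      · filter_upwards [h3, hDb j (by omega)] with ω a b
        push_cast
        linarith
      · simp only [Real.exp_add]
        refine (integral_mul_exp_le (C := Real.exp (j * (|l| * B))) (hF j (by omega)) hB
          (Real.continuous_exp.comp_aestronglyMeasurable (h2 (by omega))) ?_ (hZm j (by omega))
          (hZ j (by omega)) (hq j (by omega)) (hwm j (by omega)) (hw j (by omega)) l).trans h4
        filter_upwards [h3] with ω a
        exact ⟨(Real.exp_pos _).le, Real.exp_le_exp.2 a⟩
  obtain ⟨h1, _, h3, h4⟩ := main n le_rfl
  refine ⟨Integrable.of_bound (Real.continuous_exp.comp_aestronglyMeasurable h1)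
    (Real.exp (n * (|l| * B))) ?_, h4⟩
  filter_upwards [h3] with ω a
  rw [Real.norm_eq_abs, Real.abs_exp]
  exact Real.exp_le_exp.2 a

/-- Azuma–Hoeffding on the event of a given number `N` of active steps (one tail of sign `e`). -/
theorem measure_count_deviation_le {F : ℕ → MeasurableSpace Ω} {n : ℕ} {Z q w : ℕ → Ω → ℝ} {B : ℝ}
    (hB : 0 < B) (hF : ∀ i < n, F i ≤ m0) (hmono : ∀ i, i + 1 < n → F i ≤ F (i + 1))
    (hZm : ∀ i < n, AEStronglyMeasurable (Z i) μ)
    (hZF : ∀ i, i + 1 < n → AEStronglyMeasurable[F (i + 1)] (Z i) μ)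
    (hZ : ∀ i < n, ∀ᵐ ω ∂μ, Z i ω ∈ Set.Icc 0 B)
    (hq : ∀ i < n, μ[Z i | F i] =ᵐ[μ] q i)
    (hwm : ∀ i < n, AEStronglyMeasurable[F i] (w i) μ)
    (hw : ∀ i < n, ∀ᵐ ω ∂μ, w i ω = 1 ∨ (w i ω = 0 ∧ q i ω = 0))
    {N y e : ℝ} (hN : 0 < N) (hy : 0 ≤ y) (he : e ^ 2 = 1) :
    μ {ω | ∑ i ∈ Finset.range n, w i ω = N ∧
        B * √(N * y) < e * ∑ i ∈ Finset.range n, (Z i ω - q i ω)}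
      ≤ ENNReal.ofReal (Real.exp (-2 * y)) := by
  -- This `l` maximizes the Chernoff exponent |l| B √(N y) − N l² B²/8, with maximum 4y − 2y = 2y.
  -- It is deterministic only because `N` is fixed.
  set l : ℝ := e * (4 * √(y / N) / B) with hl
  obtain ⟨hint, hle⟩ := integral_exp_sum_le_one hB hF hmono hZm hZF hZ hq hwm hw l
  set E : Ω → ℝ := fun ω => Real.exp (∑ i ∈ Finset.range n,
    (l * (Z i ω - q i ω) - w i ω * (l ^ 2 * B ^ 2 / 8))) with hE
  have hsub : {ω | ∑ i ∈ Finset.range n, w i ω = N ∧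
      B * √(N * y) < e * ∑ i ∈ Finset.range n, (Z i ω - q i ω)}
      ⊆ {ω | Real.exp (2 * y) ≤ E ω} := by
    rintro ω ⟨h1, h2⟩
    refine Real.exp_le_exp.2 ?_
    rw [Finset.sum_sub_distrib, ← Finset.mul_sum, ← Finset.sum_mul, h1]
    have hl2 : l ^ 2 * B ^ 2 = 16 * (y / N) := by
      rw [hl, mul_pow, he, one_mul, div_pow, mul_pow, Real.sq_sqrt (div_nonneg hy hN.le)]
      field_simp
      ring
    have h3 : l * ∑ i ∈ Finset.range n, (Z i ω - q i ω)
        = 4 * √(y / N) / B * (e * ∑ i ∈ Finset.range n, (Z i ω - q i ω)) := by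
      rw [hl]; ring
    have h4 : 4 * √(y / N) / B * (B * √(N * y)) = 4 * y := by
      have : √(y / N) * √(N * y) = y := by
        rw [← Real.sqrt_mul (div_nonneg hy hN.le)]
        have : y / N * (N * y) = y ^ 2 := by field_simp
        rw [this, Real.sqrt_sq hy]
      calc 4 * √(y / N) / B * (B * √(N * y)) = 4 * (√(y / N) * √(N * y)) * (B / B) := by ring
        _ = 4 * y := by rw [this, div_self hB.ne', mul_one]
    have h5 : 4 * √(y / N) / B * (B * √(N * y)) ≤ l * ∑ i ∈ Finset.range n, (Z i ω - q i ω) := by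
      rw [h3]
      exact mul_le_mul_of_nonneg_left h2.le (by positivity)
    have h6 : N * (l ^ 2 * B ^ 2 / 8) = 2 * y := by
      rw [hl2]; field_simp; ring
    linarith
  have hmarkov := mul_meas_ge_le_integral_of_nonneg
    (Filter.Eventually.of_forall fun ω => (Real.exp_pos _).le) hint (Real.exp (2 * y))
  calc _ ≤ μ {ω | Real.exp (2 * y) ≤ E ω} := measure_mono hsub
    _ = ENNReal.ofReal (μ.real {ω | Real.exp (2 * y) ≤ E ω}) := by simp
    _ ≤ _ := by
      refine ENNReal.ofReal_le_ofReal ?_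
      have h : Real.exp (-2 * y) = 1 / Real.exp (2 * y) := by
        rw [neg_mul, Real.exp_neg, one_div]
      rw [h, le_div_iff₀ (Real.exp_pos _), mul_comm]
      exact hmarkov.trans hle

/-- Azuma–Hoeffding, uniformly over the number of active steps. -/
theorem measure_deviation_le {F : ℕ → MeasurableSpace Ω} {n : ℕ} {Z q w : ℕ → Ω → ℝ} {B : ℝ}
    (hB : 0 < B) (hF : ∀ i < n, F i ≤ m0) (hmono : ∀ i, i + 1 < n → F i ≤ F (i + 1))
    (hZm : ∀ i < n, AEStronglyMeasurable (Z i) μ)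
    (hZF : ∀ i, i + 1 < n → AEStronglyMeasurable[F (i + 1)] (Z i) μ)
    (hZ : ∀ i < n, ∀ᵐ ω ∂μ, Z i ω ∈ Set.Icc 0 B)
    (hq : ∀ i < n, μ[Z i | F i] =ᵐ[μ] q i)
    (hwm : ∀ i < n, AEStronglyMeasurable[F i] (w i) μ)
    (hw : ∀ i < n, ∀ᵐ ω ∂μ, w i ω = 1 ∨ (w i ω = 0 ∧ q i ω = 0)) {y : ℝ} (hy : 0 ≤ y) :
    μ {ω | 0 < ∑ i ∈ Finset.range n, w i ω ∧
        B * √((∑ i ∈ Finset.range n, w i ω) * y) < |∑ i ∈ Finset.range n, (Z i ω - q i ω)|}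
      ≤ ENNReal.ofReal (2 * n * Real.exp (-2 * y)) := by
  set T : ℕ → ℝ → Set Ω := fun N e => {ω | ∑ i ∈ Finset.range n, w i ω = N ∧
        B * √(N * y) < e * ∑ i ∈ Finset.range n, (Z i ω - q i ω)} with hT
  have hcount : ∀ᵐ ω ∂μ, ∃ N ≤ n, ∑ i ∈ Finset.range n, w i ω = (N : ℝ) := by
    have hall : ∀ᵐ ω ∂μ, ∀ i ∈ Finset.range n, w i ω = 1 ∨ w i ω = 0 := by
      rw [Finset.eventually_all]
      exact fun i hi => (hw i (Finset.mem_range.1 hi)).mono fun ω h => h.imp id And.left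
    filter_upwards [hall] with ω h
    refine ⟨((Finset.range n).filter fun i => w i ω = 1).card,
      (Finset.card_filter_le _ _).trans (by simp), ?_⟩
    rw [Finset.card_filter]
    push_cast
    refine Finset.sum_congr rfl fun i hi => ?_
    rcases h i hi with h | h <;> simp [h]
  -- The number of active steps is almost surely an integer in 1, …, n here; a union over its value
  -- and over the two signs produces the factor `2 * n`.
  have hsub : {ω | 0 < ∑ i ∈ Finset.range n, w i ω ∧
        B * √((∑ i ∈ Finset.range n, w i ω) * y) < |∑ i ∈ Finset.range n, (Z i ω - q i ω)|}
      ≤ᵐ[μ] ⋃ N ∈ Finset.Icc 1 n, (T N 1 ∪ T N (-1)) := by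
    filter_upwards [hcount] with ω ⟨N, hN, hw⟩ ⟨h1, h2⟩
    rw [hw] at h1 h2
    have hN1 : 1 ≤ N := by
      have : 0 < N := by exact_mod_cast h1
      omega
    refine Set.mem_iUnion₂.2 ⟨N, Finset.mem_Icc.2 ⟨hN1, hN⟩, ?_⟩
    rcases lt_abs.1 h2 with h | h
    · exact Or.inl ⟨hw, by rwa [one_mul]⟩
    · exact Or.inr ⟨hw, by rwa [neg_one_mul]⟩
  refine (measure_mono_ae hsub).trans ((measure_biUnion_finset_le _ _).trans ?_)
  have hTle : ∀ N ∈ Finset.Icc 1 n, ∀ e : ℝ, e ^ 2 = 1 →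
      μ (T N e) ≤ ENNReal.ofReal (Real.exp (-2 * y)) := fun N hN e he =>
    measure_count_deviation_le hB hF hmono hZm hZF hZ hq hwm hw
      (by have := (Finset.mem_Icc.1 hN).1; exact_mod_cast this) hy he
  calc ∑ N ∈ Finset.Icc 1 n, μ (T N 1 ∪ T N (-1))
      ≤ ∑ N ∈ Finset.Icc 1 n, ENNReal.ofReal (2 * Real.exp (-2 * y)) := by
        refine Finset.sum_le_sum fun N hN => (measure_union_le _ _).trans ?_
        rw [two_mul, ENNReal.ofReal_add (Real.exp_pos _).le (Real.exp_pos _).le]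
        exact add_le_add (hTle N hN 1 (by norm_num)) (hTle N hN (-1) (by norm_num))
    _ = _ := by
        rw [Finset.sum_const, Nat.card_Icc, Nat.add_sub_cancel, nsmul_eq_mul,
          ← ENNReal.ofReal_natCast, ← ENNReal.ofReal_mul (by positivity)]
        ring_nf

/-- Flattens episodes and steps into one time axis by Euclidean division; both coordinates are
shifted since they start at 1. -/
theorem sum_range_mul_eq {α : Type*} [AddCommMonoid α] {H : ℕ} (hH : 0 < H) (G : ℕ → ℕ → α)
    (k : ℕ) : ∑ i ∈ Finset.range (k * H), G (i / H + 1) (i % H + 1)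
      = ∑ t ∈ Finset.Ico 1 (k + 1), ∑ h ∈ Finset.Icc 1 H, G t h := by
  induction k with
  | zero => simp
  | succ k ih =>
    rw [Finset.sum_Ico_succ_top (by omega), ← ih, Nat.succ_mul, Finset.sum_range_add]
    congr 1
    rw [← Finset.Ico_add_one_right_eq_Icc, Finset.sum_Ico_eq_sum_range]
    refine Finset.sum_congr rfl fun i hi => ?_
    have hi := Finset.mem_range.1 hi
    have h1 : (k * H + i) / H = k := by
      rw [mul_comm, Nat.mul_add_div hH, Nat.div_eq_of_lt (by omega), add_zero]
    have h2 : (k * H + i) % H = i := by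
      rw [mul_comm, Nat.mul_add_mod, Nat.mod_eq_of_lt (by omega)]
    rw [h1, h2, add_comm 1 i]

/-- Azuma–Hoeffding for processes indexed by episodes and steps. -/
theorem measure_episodic_deviation_le {F : ℕ → ℕ → MeasurableSpace Ω} {H k : ℕ} (hH : 0 < H)
    {Z q w : ℕ → ℕ → Ω → ℝ} {B : ℝ} (hB : 0 < B)
    (hF : ∀ t ∈ Finset.Icc 1 k, ∀ h ∈ Finset.Icc 1 H, F t h ≤ m0)
    (hstep : ∀ t ∈ Finset.Icc 1 k, ∀ h ∈ Finset.Ico 1 H, F t h ≤ F t (h + 1))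
    (hepi : ∀ t ∈ Finset.Ico 1 k, F t H ≤ F (t + 1) 1)
    (hZm : ∀ t ∈ Finset.Icc 1 k, ∀ h ∈ Finset.Icc 1 H, AEStronglyMeasurable (Z t h) μ)
    (hZstep : ∀ t ∈ Finset.Icc 1 k, ∀ h ∈ Finset.Ico 1 H,
      AEStronglyMeasurable[F t (h + 1)] (Z t h) μ)
    (hZepi : ∀ t ∈ Finset.Ico 1 k, AEStronglyMeasurable[F (t + 1) 1] (Z t H) μ)
    (hZ : ∀ t ∈ Finset.Icc 1 k, ∀ h ∈ Finset.Icc 1 H, ∀ᵐ ω ∂μ, Z t h ω ∈ Set.Icc 0 B)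
    (hq : ∀ t ∈ Finset.Icc 1 k, ∀ h ∈ Finset.Icc 1 H, μ[Z t h | F t h] =ᵐ[μ] q t h)
    (hwm : ∀ t ∈ Finset.Icc 1 k, ∀ h ∈ Finset.Icc 1 H, AEStronglyMeasurable[F t h] (w t h) μ)
    (hw : ∀ t ∈ Finset.Icc 1 k, ∀ h ∈ Finset.Icc 1 H,
      ∀ᵐ ω ∂μ, w t h ω = 1 ∨ (w t h ω = 0 ∧ q t h ω = 0)) {y : ℝ} (hy : 0 ≤ y) :
    μ {ω | 0 < ∑ t ∈ Finset.Ico 1 (k + 1), ∑ h ∈ Finset.Icc 1 H, w t h ω ∧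
        B * √((∑ t ∈ Finset.Ico 1 (k + 1), ∑ h ∈ Finset.Icc 1 H, w t h ω) * y)
          < |∑ t ∈ Finset.Ico 1 (k + 1), ∑ h ∈ Finset.Icc 1 H, (Z t h ω - q t h ω)|}
      ≤ ENNReal.ofReal (2 * (k * H) * Real.exp (-2 * y)) := by
  have ht : ∀ i < k * H, i / H + 1 ∈ Finset.Icc 1 k := fun i hi => by
    have := Nat.div_lt_of_lt_mul (by rwa [mul_comm] at hi : i < H * k)
    exact Finset.mem_Icc.2 ⟨Nat.le_add_left 1 _, this⟩
  have hh : ∀ i, i % H + 1 ∈ Finset.Icc 1 H := fun i => by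
    have := Nat.mod_lt i hH
    exact Finset.mem_Icc.2 ⟨by omega, by omega⟩
  -- The next time index is either the next step of the same episode or the first step of the
  -- following one.
  have hsucc : ∀ i, (i % H + 1 < H ∧ (i + 1) / H = i / H ∧ (i + 1) % H = i % H + 1) ∨
      (i % H + 1 = H ∧ (i + 1) / H = i / H + 1 ∧ (i + 1) % H = 0) := fun i => by
    have h1 := Nat.mod_lt i hH
    have h2 := Nat.div_add_mod i H
    rcases (show i % H + 1 < H ∨ i % H + 1 = H by omega) with h | h
    · left
      have e : i + 1 = H * (i / H) + (i % H + 1) := by omega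
      refine ⟨h, ?_, ?_⟩
      · conv_lhs => rw [e]
        rw [Nat.mul_add_div hH, Nat.div_eq_of_lt h, add_zero]
      · conv_lhs => rw [e]
        rw [Nat.mul_add_mod, Nat.mod_eq_of_lt h]
    · right
      have e : i + 1 = H * (i / H + 1) := by rw [mul_add, mul_one]; omega
      refine ⟨h, ?_, ?_⟩
      · conv_lhs => rw [e]
        exact Nat.mul_div_cancel_left _ hH
      · conv_lhs => rw [e]
        exact Nat.mul_mod_right _ _
  have hnext : ∀ i, i + 1 < k * H →
      F (i / H + 1) (i % H + 1) ≤ F ((i + 1) / H + 1) ((i + 1) % H + 1) ∧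
      AEStronglyMeasurable[F ((i + 1) / H + 1) ((i + 1) % H + 1)]
        (Z (i / H + 1) (i % H + 1)) μ := fun i hi => by
    have h1 := Finset.mem_Icc.1 (ht i (by omega))
    have h2 := Finset.mem_Icc.1 (ht (i + 1) hi)
    rcases hsucc i with ⟨h, e1, e2⟩ | ⟨h, e1, e2⟩
    · rw [e1, e2]
      exact ⟨hstep _ (ht i (by omega)) _ (Finset.mem_Ico.2 ⟨by omega, h⟩),
        hZstep _ (ht i (by omega)) _ (Finset.mem_Ico.2 ⟨by omega, h⟩)⟩
    · rw [e1, e2, h]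
      have hm : i / H + 1 ∈ Finset.Ico 1 k := Finset.mem_Ico.2 ⟨by omega, by omega⟩
      exact ⟨hepi _ hm, hZepi _ hm⟩
  have key := measure_deviation_le (μ := μ) (n := k * H)
    (F := fun i => F (i / H + 1) (i % H + 1)) (Z := fun i => Z (i / H + 1) (i % H + 1))
    (q := fun i => q (i / H + 1) (i % H + 1)) (w := fun i => w (i / H + 1) (i % H + 1)) hB
    (fun i hi => hF _ (ht i hi) _ (hh i)) (fun i hi => (hnext i hi).1)
    (fun i hi => hZm _ (ht i hi) _ (hh i)) (fun i hi => (hnext i hi).2)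
    (fun i hi => hZ _ (ht i hi) _ (hh i)) (fun i hi => hq _ (ht i hi) _ (hh i))
    (fun i hi => hwm _ (ht i hi) _ (hh i)) (fun i hi => hw _ (ht i hi) _ (hh i)) hy
  have e1 : ∀ ω, ∑ i ∈ Finset.range (k * H), w (i / H + 1) (i % H + 1) ω
      = ∑ t ∈ Finset.Ico 1 (k + 1), ∑ h ∈ Finset.Icc 1 H, w t h ω :=
    fun ω => sum_range_mul_eq hH (fun t h => w t h ω) k
  have e2 : ∀ ω, ∑ i ∈ Finset.range (k * H),
        (Z (i / H + 1) (i % H + 1) ω - q (i / H + 1) (i % H + 1) ω)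
      = ∑ t ∈ Finset.Ico 1 (k + 1), ∑ h ∈ Finset.Icc 1 H, (Z t h ω - q t h ω) :=
    fun ω => sum_range_mul_eq hH (fun t h => Z t h ω - q t h ω) k
  simp only [e1, e2] at key
  push_cast at key
  exact key

end Concentration

/-! ### Conditioning on finite-valued variables -/

section FiniteValued

variable {Ω ι : Type*} [Fintype ι] {m m0 : MeasurableSpace Ω} {μ : Measure Ω}

theorem measurable_eval_finite [DecidableEq ι] {Y : Ω → ι} {F : ι → Ω → ℝ}
    (hY : ∀ i, MeasurableSet[m] {ω | Y ω = i}) (hF : ∀ i, Measurable[m] (F i)) :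
    Measurable[m] (fun ω => F (Y ω) ω) := by
  have : (fun ω => F (Y ω) ω) = fun ω => ∑ i, if Y ω = i then F i ω else 0 := by
    ext ω; simp
  rw [this]
  exact Finset.measurable_sum _ fun i _ => Measurable.ite (hY i) (hF i) measurable_const

/-- Conditional expectation of a function of a finite-valued variable with known conditional law,
the function itself being known. -/
theorem condExp_eval_finite [IsProbabilityMeasure μ] [DecidableEq ι] (hm : m ≤ m0) {Y : Ω → ι}
    {F q : ι → Ω → ℝ} {C : ℝ} (hY : ∀ i, MeasurableSet[m0] {ω | Y ω = i})
    (hF : ∀ i, Measurable[m] (F i)) (hFb : ∀ i, ∀ᵐ ω ∂μ, |F i ω| ≤ C)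
    (hq : ∀ i, μ[(fun ω => if Y ω = i then (1 : ℝ) else 0) | m] =ᵐ[μ] q i) :
    μ[(fun ω => F (Y ω) ω) | m] =ᵐ[μ] fun ω => ∑ i, q i ω * F i ω := by
  have hI : ∀ i, Integrable (fun ω => if Y ω = i then (1 : ℝ) else 0) μ := fun i =>
    Integrable.of_bound (Measurable.ite (hY i) measurable_const
      measurable_const).aestronglyMeasurable 1 (Filter.Eventually.of_forall fun ω => by
        split_ifs <;> simp)
  -- Splitting over the values of `Y` isolates factors `F i` that are `m`-measurable and can be
  -- pulled out.
  have e : (fun ω => F (Y ω) ω) = ∑ i, F i * (fun ω => if Y ω = i then (1 : ℝ) else 0) := by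
    ext ω; simp
  rw [e]
  have hpull : ∀ i, μ[F i * (fun ω => if Y ω = i then (1 : ℝ) else 0) | m]
      =ᵐ[μ] F i * μ[(fun ω => if Y ω = i then (1 : ℝ) else 0) | m] := fun i =>
    condExp_stronglyMeasurable_mul_of_bound hm (hF i).stronglyMeasurable (hI i) C (hFb i)
  have hsum := condExp_finsetSum (μ := μ) (s := (Finset.univ : Finset ι))
    (f := fun i => F i * (fun ω => if Y ω = i then (1 : ℝ) else 0))
    (fun i _ => (hI i).bdd_mul ((hF i).mono hm le_rfl).aestronglyMeasurable (hFb i)) m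
  have hall : ∀ᵐ ω ∂μ, ∀ i, (μ[F i * (fun ω => if Y ω = i then (1 : ℝ) else 0) | m]) ω
      = F i ω * q i ω := by
    rw [Filter.eventually_all]
    intro i
    filter_upwards [hpull i, hq i] with ω a b
    rw [a, Pi.mul_apply, b]
  filter_upwards [hsum, hall] with ω a b
  rw [a, Finset.sum_apply]
  exact Finset.sum_congr rfl fun i _ => by rw [b i, mul_comm]

end FiniteValued

/-! ### Empirical means as normalized sums over visits -/

section Estimation

variable {S A D : Type*} [DecidableEq S] [DecidableEq A]

/-- Average of the signal `y` over the visits to `(s, a)` before episode `k`. -/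
def empMean (H : ℕ) (x : Record S A D) (k : ℕ) (y : ℕ → ℕ → ℝ) (s : S) (a : A) : ℝ :=
  (1 / visits H x k s a) * ∑ t ∈ Finset.Ico 1 k, ∑ h ∈ Finset.Icc 1 H,
    if x.state t h = s ∧ x.action t h = a then y t h else 0

variable (H : ℕ) (x : Record S A D) (k : ℕ) (s : S) (a : A)

theorem visits_pos : 0 < visits H x k s a := one_pos.trans_le (one_le_visits H x k s a)

theorem empMean_mem {y : ℕ → ℕ → ℝ} {B : ℝ} (hB : 0 ≤ B)
    (hy : ∀ t ∈ Finset.Ico 1 k, ∀ h ∈ Finset.Icc 1 H, y t h ∈ Set.Icc 0 B) :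
    empMean H x k y s a ∈ Set.Icc 0 B := by
  have hpos := visits_pos H x k s a
  constructor
  · refine mul_nonneg (by positivity) (Finset.sum_nonneg fun t ht => Finset.sum_nonneg fun h hh => ?_)
    split_ifs
    exacts [(hy t ht h hh).1, le_rfl]
  · rw [empMean, one_div, inv_mul_le_iff₀ hpos]
    calc _ ≤ ∑ t ∈ Finset.Ico 1 k, ∑ h ∈ Finset.Icc 1 H,
          (if x.state t h = s ∧ x.action t h = a then (1 : ℝ) else 0) * B := by
          refine Finset.sum_le_sum fun t ht => Finset.sum_le_sum fun h hh => ?_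
          split_ifs
          · rw [one_mul]; exact (hy t ht h hh).2
          · rw [zero_mul]
      _ = visitCount H x k s a * B := by simp only [visitCount, Finset.sum_mul]
      _ ≤ _ := mul_le_mul_of_nonneg_right (le_max_right _ _) hB

/-- Grouping visits by their successor state. Signal and next-state value can thus be treated as a
single averaged quantity, with one deviation bound for both. -/
theorem sum_pHat_mul [Fintype S] (φ : S → ℝ) :
    ∑ s', pHat H x k s a s' * φ s' = empMean H x k (fun t h => φ (x.state t (h + 1))) s a := by
  simp only [pHat, empMean, mul_assoc, ← Finset.mul_sum, Finset.sum_mul]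
  congr 1
  rw [Finset.sum_comm]
  refine Finset.sum_congr rfl fun t _ => ?_
  rw [Finset.sum_comm]
  refine Finset.sum_congr rfl fun h _ => ?_
  by_cases h1 : x.state t h = s ∧ x.action t h = a
  · simp [h1.1, h1.2]
  · rw [if_neg h1]
    refine Finset.sum_eq_zero fun s' _ => ?_
    rw [if_neg (fun h => h1 ⟨h.1, h.2.1⟩), zero_mul]

/-- A row sums to the true count over its truncation: 1 for a visited pair and 0 for an unvisited
one, hence only substochastic. -/
theorem pHat_isSubstochastic [Fintype S] : IsSubstochastic (pHat H x k) := by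
  refine ⟨fun s a s' => mul_nonneg ?_ (Finset.sum_nonneg fun t _ => Finset.sum_nonneg fun h _ => ?_),
    fun s a => ?_⟩
  · have := visits_pos H x k s a
    positivity
  · split_ifs <;> simp
  · have h1 := sum_pHat_mul H x k s a (fun _ => (1 : ℝ))
    simp only [mul_one] at h1
    rw [h1]
    exact (empMean_mem H x k s a zero_le_one fun _ _ _ _ => ⟨zero_le_one, le_rfl⟩).2

variable {H x k s a}

theorem empMean_eq_zero {y : ℕ → ℕ → ℝ} (h0 : visitCount H x k s a = 0) :
    empMean H x k y s a = 0 := by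
  have h1 : ∀ t ∈ Finset.Ico 1 k, ∀ h ∈ Finset.Icc 1 H,
      ¬ (x.state t h = s ∧ x.action t h = a) := by
    intro t ht h hh hc
    have := (Finset.sum_eq_zero_iff_of_nonneg fun t _ => Finset.sum_nonneg fun h _ => by
      split_ifs <;> simp).1 h0 t ht
    have := (Finset.sum_eq_zero_iff_of_nonneg fun h _ => by split_ifs <;> simp).1 this h hh
    simp [hc] at this
  rw [empMean, Finset.sum_eq_zero fun t ht => Finset.sum_eq_zero fun h hh =>
    if_neg (h1 t ht h hh), mul_zero]

/-- Division of a summed deviation by the visit count N turns √(N ε) into √(ε / N). -/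
theorem abs_estimate_sub_le [Fintype S] {y : ℕ → ℕ → ℝ} {φ : S → ℝ} {c B ε : ℝ}
    (hpos : 0 < visitCount H x k s a)
    (hdev : |∑ t ∈ Finset.Ico 1 k, ∑ h ∈ Finset.Icc 1 H,
      (if x.state t h = s ∧ x.action t h = a then y t h + φ (x.state t (h + 1)) - c else 0)|
      ≤ B * √(visitCount H x k s a * ε)) :
    |empMean H x k y s a + ∑ s', pHat H x k s a s' * φ s' - c| ≤ B * √(ε / visits H x k s a) := by
  rw [visits_eq_of_pos hpos]
  have e : ∑ t ∈ Finset.Ico 1 k, ∑ h ∈ Finset.Icc 1 H,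
      (if x.state t h = s ∧ x.action t h = a then y t h + φ (x.state t (h + 1)) - c else 0)
      = visitCount H x k s a * (empMean H x k y s a + ∑ s', pHat H x k s a s' * φ s' - c) := by
    have h1 : ∀ z : ℕ → ℕ → ℝ, visitCount H x k s a * empMean H x k z s a
        = ∑ t ∈ Finset.Ico 1 k, ∑ h ∈ Finset.Icc 1 H,
          if x.state t h = s ∧ x.action t h = a then z t h else 0 := by
      intro z
      rw [empMean, visits_eq_of_pos hpos, ← mul_assoc, mul_one_div_cancel hpos.ne', one_mul]
    rw [sum_pHat_mul, mul_sub, mul_add, h1, h1]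
    simp only [visitCount, Finset.sum_mul, ← Finset.sum_add_distrib, ← Finset.sum_sub_distrib]
    refine Finset.sum_congr rfl fun t _ => Finset.sum_congr rfl fun h _ => ?_
    split_ifs <;> simp
  rw [e, abs_mul, abs_of_pos hpos] at hdev
  set N := visitCount H x k s a
  have h2 : √(N * ε) = N * √(ε / N) := by
    have : N * ε = N ^ 2 * (ε / N) := by field_simp
    rw [this, Real.sqrt_mul (by positivity), Real.sqrt_sq hpos.le]
  rw [h2] at hdev
  refine le_of_mul_le_mul_left (hdev.trans (le_of_eq ?_)) hpos
  ring

/-- Apply the hypothesis to the index sets where `v` is nonnegative and where it is negative. This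
turns a union bound over subsets of states into ℓ¹ closeness. -/
theorem sum_abs_le_of_subset_sums {ι : Type*} [Fintype ι] {v : ι → ℝ} {ε : ℝ}
    (h : ∀ T : Finset ι, |∑ i ∈ T, v i| ≤ ε) : ∑ i, |v i| ≤ 2 * ε := by
  classical
  have h1 := h (Finset.univ.filter fun i => 0 ≤ v i)
  have h2 := h (Finset.univ.filter fun i => ¬ 0 ≤ v i)
  rw [← Finset.sum_filter_add_sum_filter_not Finset.univ (fun i => 0 ≤ v i)]
  rw [Finset.sum_congr rfl fun i hi => abs_of_nonneg (Finset.mem_filter.1 hi).2,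
    Finset.sum_congr rfl fun i hi => abs_of_neg (not_le.1 (Finset.mem_filter.1 hi).2),
    Finset.sum_neg_distrib]
  linarith [(abs_le.1 h1).2, (abs_le.1 h2).1]

end Estimation

/-! ### Martingale deviations along the interaction -/

section Interaction

variable {S A D Ω : Type*} [Fintype S] [Fintype A] [DecidableEq S] [DecidableEq A]
  [m0 : MeasurableSpace Ω] {μ : Measure Ω} {M : CMDP S A D} {H K : ℕ} {s₀ : S}
  {past : ℕ → ℕ → MeasurableSpace Ω} {π : ℕ → Ω → ℕ → S → A → ℝ} {X : Ω → Record S A D}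

/-- The information available just after the action of step `h` in episode `t`. -/
abbrev pastAction (past : ℕ → ℕ → MeasurableSpace Ω) (X : Ω → Record S A D) (t h : ℕ) :
    MeasurableSpace Ω :=
  past t h ⊔ MeasurableSpace.comap (fun ω => (X ω).action t h) ⊤

namespace IsInteraction

theorem pastAction_le_past_succ (hX : IsInteraction μ M H K s₀ past π X) {t h : ℕ}
    (ht : t ∈ Finset.Icc 1 K) (hh : h ∈ Finset.Icc 1 H) :
    pastAction past X t h ≤ past t (h + 1) := by
  refine sup_le (hX.past_step t ht h hh) ?_
  rintro _ ⟨U, -, rfl⟩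
  have : (fun ω => (X ω).action t h) ⁻¹' U = ⋃ a ∈ U, {ω | (X ω).action t h = a} := by
    ext ω; simp
  rw [this]
  exact MeasurableSet.biUnion (Set.to_countable U) fun a _ => hX.action_meas t ht h hh a

theorem past_le_past (hX : IsInteraction μ M H K s₀ past π X) {t h h' : ℕ}
    (ht : t ∈ Finset.Icc 1 K) (h1 : 1 ≤ h) (hhh : h ≤ h') (hH : h' ≤ H + 1) :
    past t h ≤ past t h' := by
  induction h', hhh using Nat.le_induction with
  | base => exact le_rfl
  | succ n hn ih =>
    exact (ih (by omega)).trans (hX.past_step t ht n (Finset.mem_Icc.2 ⟨by omega, by omega⟩))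

theorem past_end_le_past_start (hX : IsInteraction μ M H K s₀ past π X) {t t' : ℕ}
    (h1 : 1 ≤ t) (htt : t < t') (hK : t' ≤ K) : past t (H + 1) ≤ past t' 1 := by
  induction t', (Nat.succ_le_of_lt htt) using Nat.le_induction with
  | base => exact hX.past_episode t (Finset.mem_Ico.2 ⟨h1, by omega⟩)
  | succ n hn ih =>
    have hn' : n ∈ Finset.Icc 1 K := Finset.mem_Icc.2 ⟨by omega, by omega⟩
    exact ((ih (by omega) (by omega)).trans (hX.past_le_past hn' le_rfl (by omega) le_rfl)).trans
      (hX.past_episode n (Finset.mem_Ico.2 ⟨by omega, by omega⟩))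

theorem pastAction_le (hX : IsInteraction μ M H K s₀ past π X) {t h : ℕ}
    (ht : t ∈ Finset.Icc 1 K) (hh : h ∈ Finset.Icc 1 H) : pastAction past X t h ≤ m0 := by
  have := Finset.mem_Icc.1 hh
  exact (hX.pastAction_le_past_succ ht hh).trans
    (hX.past_le t ht (h + 1) (Finset.mem_Icc.2 ⟨by omega, by omega⟩))

theorem state_meas_succ (hX : IsInteraction μ M H K s₀ past π X) {t h : ℕ}
    (ht : t ∈ Finset.Icc 1 K) (hh : h ∈ Finset.Icc 1 H) (s : S) :
    MeasurableSet[past t (h + 1)] {ω | (X ω).state t (h + 1) = s} := by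
  have := Finset.mem_Icc.1 hh
  exact hX.state_meas t ht (h + 1) (Finset.mem_Icc.2 ⟨by omega, by omega⟩) s

theorem state_meas_pastAction (hX : IsInteraction μ M H K s₀ past π X) {t h : ℕ}
    (ht : t ∈ Finset.Icc 1 K) (hh : h ∈ Finset.Icc 1 H) (s : S) :
    MeasurableSet[pastAction past X t h] {ω | (X ω).state t h = s} := by
  have := Finset.mem_Icc.1 hh
  exact (le_sup_left : past t h ≤ pastAction past X t h) _
    (hX.state_meas t ht h (Finset.mem_Icc.2 ⟨by omega, by omega⟩) s)

omit [Fintype S] [Fintype A] [DecidableEq S] [DecidableEq A] m0 in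
theorem action_meas_pastAction (past : ℕ → ℕ → MeasurableSpace Ω) (X : Ω → Record S A D)
    (t h : ℕ) (a : A) : MeasurableSet[pastAction past X t h] {ω | (X ω).action t h = a} :=
  (le_sup_right : _ ≤ pastAction past X t h) _ ⟨{a}, trivial, rfl⟩

theorem visit_meas (hX : IsInteraction μ M H K s₀ past π X) {t h : ℕ}
    (ht : t ∈ Finset.Icc 1 K) (hh : h ∈ Finset.Icc 1 H) (s : S) (a : A) :
    MeasurableSet[pastAction past X t h]
      {ω | (X ω).state t h = s ∧ (X ω).action t h = a} :=
  MeasurableSet.inter (hX.state_meas_pastAction ht hh s) (action_meas_pastAction past X t h a)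

/-- The count before episode `k` involves earlier episodes only, so error bounds built from it are
known when episode `k` starts. -/
theorem visits_meas (hX : IsInteraction μ M H K s₀ past π X) {k : ℕ}
    (hk : k ∈ Finset.Icc 1 K) (s : S) (a : A) :
    Measurable[past k 1] (fun ω => visits H (X ω) k s a) := by
  have hk' := Finset.mem_Icc.1 hk
  refine Measurable.max measurable_const (Finset.measurable_sum _ fun t ht =>
    Finset.measurable_sum _ fun h hh => Measurable.ite ?_ measurable_const measurable_const)
  have ht' := Finset.mem_Ico.1 ht
  have hh' := Finset.mem_Icc.1 hh
  have htK : t ∈ Finset.Icc 1 K := Finset.mem_Icc.2 ⟨by omega, by omega⟩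
  exact ((hX.pastAction_le_past_succ htK hh).trans
    ((hX.past_le_past htK (by omega) (by omega) le_rfl).trans
      (hX.past_end_le_past_start ht'.1 ht'.2 hk'.2))) _ (hX.visit_meas htK hh s a)

variable [IsProbabilityMeasure μ]

/-- Deviation of the sums of a signal plus a function of the next state over the visits to one
state-action pair. -/
theorem measure_visit_deviation_le (hX : IsInteraction μ M H K s₀ past π X) (hH : 0 < H) {k : ℕ}
    (hk : k ∈ Finset.Icc 1 K) (s : S) (a : A) {Y : ℕ → ℕ → Ω → ℝ} {m : S → A → ℝ} {φ : S → ℝ}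
    {B y : ℝ} (hB : 0 < B) (hy : 0 ≤ y)
    (hYm : ∀ t ∈ Finset.Icc 1 K, ∀ h ∈ Finset.Icc 1 H, Measurable[past t (h + 1)] (Y t h))
    (hYmean : ∀ t ∈ Finset.Icc 1 K, ∀ h ∈ Finset.Icc 1 H,
      μ[Y t h | pastAction past X t h] =ᵐ[μ] fun ω => m ((X ω).state t h) ((X ω).action t h))
    (hYb : ∀ t ∈ Finset.Icc 1 K, ∀ h ∈ Finset.Icc 1 H,
      ∀ᵐ ω ∂μ, ∀ s', Y t h ω + φ s' ∈ Set.Icc 0 B) :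
    μ {ω | 0 < visitCount H (X ω) k s a ∧ B * √(visitCount H (X ω) k s a * y)
        < |∑ t ∈ Finset.Ico 1 k, ∑ h ∈ Finset.Icc 1 H,
          (if (X ω).state t h = s ∧ (X ω).action t h = a then
            Y t h ω + φ ((X ω).state t (h + 1)) - (m s a + ∑ s', M.p s a s' * φ s') else 0)|}
      ≤ ENNReal.ofReal (2 * (k * H) * Real.exp (-2 * y)) := by
  -- Only the `k - 1` episodes before `k` enter the estimates.
  obtain ⟨j, rfl⟩ : ∃ j, k = j + 1 := ⟨k - 1, by have := Finset.mem_Icc.1 hk; omega⟩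
  have hjK : j + 1 ≤ K := (Finset.mem_Icc.1 hk).2
  have hK : ∀ t ∈ Finset.Icc 1 j, t ∈ Finset.Icc 1 K := fun t ht => by
    have := Finset.mem_Icc.1 ht
    exact Finset.mem_Icc.2 ⟨by omega, by omega⟩
  set c : ℝ := m s a + ∑ s', M.p s a s' * φ s' with hc
  set V : ℕ → ℕ → Set Ω := fun t h => {ω | (X ω).state t h = s ∧ (X ω).action t h = a} with hV
  set w : ℕ → ℕ → Ω → ℝ := fun t h ω =>
    if (X ω).state t h = s ∧ (X ω).action t h = a then (1 : ℝ) else 0 with hw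
  set U : ℕ → ℕ → Ω → ℝ := fun t h ω => Y t h ω + φ ((X ω).state t (h + 1)) with hU
  have hφm : ∀ t ∈ Finset.Icc 1 K, ∀ h ∈ Finset.Icc 1 H,
      Measurable[past t (h + 1)] (fun ω => φ ((X ω).state t (h + 1))) := fun t ht h hh =>
    measurable_eval_finite (F := fun s' _ => φ s') (hX.state_meas_succ ht hh)
      fun _ => measurable_const
  have hwm : ∀ t ∈ Finset.Icc 1 K, ∀ h ∈ Finset.Icc 1 H,
      Measurable[pastAction past X t h] (w t h) := fun t ht h hh =>
    Measurable.ite (hX.visit_meas ht hh s a) measurable_const measurable_const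
  have hZm : ∀ t ∈ Finset.Icc 1 K, ∀ h ∈ Finset.Icc 1 H,
      Measurable[past t (h + 1)] (fun ω => w t h ω * U t h ω) := fun t ht h hh =>
    ((hwm t ht h hh).mono (hX.pastAction_le_past_succ ht hh) le_rfl).mul
      ((hYm t ht h hh).add (hφm t ht h hh))
  have hle : ∀ t ∈ Finset.Icc 1 K, ∀ h ∈ Finset.Icc 1 H, past t (h + 1) ≤ m0 :=
    fun t ht h hh => by
      have := Finset.mem_Icc.1 hh
      exact hX.past_le t ht (h + 1) (Finset.mem_Icc.2 ⟨by omega, by omega⟩)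
  have hUb : ∀ t ∈ Finset.Icc 1 K, ∀ h ∈ Finset.Icc 1 H, ∀ᵐ ω ∂μ, U t h ω ∈ Set.Icc 0 B :=
    fun t ht h hh => (hYb t ht h hh).mono fun ω hω => hω _
  have hUi : ∀ t ∈ Finset.Icc 1 K, ∀ h ∈ Finset.Icc 1 H, Integrable (U t h) μ :=
    fun t ht h hh => Integrable.of_bound
      (((hYm t ht h hh).add (hφm t ht h hh)).mono (hle t ht h hh) le_rfl).aestronglyMeasurable B
      ((hUb t ht h hh).mono fun ω hω => by
        rw [Real.norm_eq_abs, abs_of_nonneg hω.1]; exact hω.2)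
  have hφb : ∀ s', |φ s'| ≤ ∑ i, |φ i| := fun s' =>
    Finset.single_le_sum (f := fun i => |φ i|) (fun i _ => abs_nonneg _) (Finset.mem_univ s')
  have hφi : ∀ t ∈ Finset.Icc 1 K, ∀ h ∈ Finset.Icc 1 H,
      Integrable (fun ω => φ ((X ω).state t (h + 1))) μ := fun t ht h hh =>
    Integrable.of_bound ((hφm t ht h hh).mono (hle t ht h hh) le_rfl).aestronglyMeasurable
      (∑ i, |φ i|) (Filter.Eventually.of_forall fun ω => hφb _)
  have hYi : ∀ t ∈ Finset.Icc 1 K, ∀ h ∈ Finset.Icc 1 H, Integrable (Y t h) μ :=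
    fun t ht h hh => ((hUi t ht h hh).sub (hφi t ht h hh)).congr
      (Filter.Eventually.of_forall fun ω => by simp [hU])
  have hUmean : ∀ t ∈ Finset.Icc 1 K, ∀ h ∈ Finset.Icc 1 H,
      μ[U t h | pastAction past X t h] =ᵐ[μ] fun ω => m ((X ω).state t h) ((X ω).action t h)
        + ∑ s', M.p ((X ω).state t h) ((X ω).action t h) s' * φ s' := fun t ht h hh => by
    have h1 := condExp_add (hYi t ht h hh) (hφi t ht h hh) (pastAction past X t h)
    have h2 := condExp_eval_finite (μ := μ) (hX.pastAction_le ht hh)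
      (Y := fun ω => (X ω).state t (h + 1)) (F := fun s' _ => φ s')
      (fun s' => hle t ht h hh _ (hX.state_meas_succ ht hh s')) (fun _ => measurable_const)
      (fun s' => Filter.Eventually.of_forall fun _ => hφb s') (hX.next_law t ht h hh)
    filter_upwards [h1, h2, hYmean t ht h hh] with ω e1 e2 e3
    exact e1.trans (by rw [Pi.add_apply, e2, e3])
  -- On a visit to `(s, a)` the conditional mean is the constant `c`; off visits everything is
  -- multiplied by zero.
  have hwU : ∀ t ∈ Finset.Icc 1 K, ∀ h ∈ Finset.Icc 1 H,
      μ[(fun ω => w t h ω * U t h ω) | pastAction past X t h] =ᵐ[μ] fun ω => w t h ω * c :=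
    fun t ht h hh => by
      have h1 := condExp_stronglyMeasurable_mul_of_bound (μ := μ) (hX.pastAction_le ht hh)
        (hwm t ht h hh).stronglyMeasurable (hUi t ht h hh) 1
        (Filter.Eventually.of_forall fun ω => by simp only [hw]; split_ifs <;> simp)
      filter_upwards [h1, hUmean t ht h hh] with ω e1 e2
      refine e1.trans ?_
      rw [Pi.mul_apply, e2]
      simp only [hw]
      split_ifs with hsa
      · rw [hsa.1, hsa.2]
      · simp
  -- The filtration includes the current action, because the visit indicator must be known before
  -- the reward and next state are revealed.
  have key := measure_episodic_deviation_le (μ := μ) (F := pastAction past X) (k := j)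
    (Z := fun t h ω => w t h ω * U t h ω) (q := fun t h ω => w t h ω * c) (w := w) hH hB
    (fun t ht h hh => hX.pastAction_le (hK t ht) hh)
    (fun t ht h hh => (hX.pastAction_le_past_succ (hK t ht) (Finset.Ico_subset_Icc_self hh)).trans
      le_sup_left)
    (fun t ht => ((hX.pastAction_le_past_succ (hK t (Finset.Ico_subset_Icc_self ht))
      (Finset.mem_Icc.2 ⟨hH, le_rfl⟩)).trans (hX.past_episode t (Finset.mem_Ico.2
        ⟨(Finset.mem_Ico.1 ht).1, by have := (Finset.mem_Ico.1 ht).2; omega⟩))).trans le_sup_left)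
    (fun t ht h hh => ((hZm t (hK t ht) h hh).mono (hle t (hK t ht) h hh)
      le_rfl).aestronglyMeasurable)
    (fun t ht h hh => ((hZm t (hK t ht) h (Finset.Ico_subset_Icc_self hh)).mono
      (le_sup_left : past t (h + 1) ≤ pastAction past X t (h + 1)) le_rfl).aestronglyMeasurable)
    (fun t ht => ((hZm t (hK t (Finset.Ico_subset_Icc_self ht)) H
      (Finset.mem_Icc.2 ⟨hH, le_rfl⟩)).mono ((hX.past_episode t (Finset.mem_Ico.2
        ⟨(Finset.mem_Ico.1 ht).1, by have := (Finset.mem_Ico.1 ht).2; omega⟩)).trans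
        (le_sup_left : past (t + 1) 1 ≤ pastAction past X (t + 1) 1))
      le_rfl).aestronglyMeasurable)
    (fun t ht h hh => (hUb t (hK t ht) h hh).mono fun ω hω => by
      simp only [hw]
      split_ifs
      · rwa [one_mul]
      · rw [zero_mul]; exact ⟨le_rfl, hB.le⟩)
    (fun t ht h hh => hwU t (hK t ht) h hh)
    (fun t ht h hh => (hwm t (hK t ht) h hh).aestronglyMeasurable)
    (fun t ht h hh => Filter.Eventually.of_forall fun ω => by
      simp only [hw]
      split_ifs <;> simp)
    hy
  have e : ∀ t h ω, (if (X ω).state t h = s ∧ (X ω).action t h = a then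
      Y t h ω + φ ((X ω).state t (h + 1)) - c else 0) = w t h ω * U t h ω - w t h ω * c := by
    intro t h ω
    simp only [hw, hU]
    split_ifs <;> simp
  simp only [e]
  refine le_trans key (ENNReal.ofReal_le_ofReal ?_)
  gcongr
  linarith

/-- Deviation along the whole trajectory: `e` and `W` are chosen at the start of each episode. -/
theorem measure_trajectory_deviation_le (hX : IsInteraction μ M H K s₀ past π X) (hH : 0 < H)
    {k : ℕ} (hk : k ∈ Finset.Icc 1 K) {e : ℕ → Ω → S → A → ℝ} {W : ℕ → Ω → ℕ → S → ℝ}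
    {E R y : ℝ} (hE : 0 < E) (hR : 0 ≤ R) (hy : 0 ≤ y)
    (hem : ∀ t ∈ Finset.Icc 1 K, ∀ s a, Measurable[past t 1] (fun ω => e t ω s a))
    (heb : ∀ t ∈ Finset.Icc 1 K, ∀ ω s a, e t ω s a ∈ Set.Icc 0 E)
    (hWm : ∀ t ∈ Finset.Icc 1 K, ∀ h ∈ Finset.Icc 1 H, ∀ s,
      Measurable[past t 1] (fun ω => W t ω h s))
    (hWb : ∀ t ∈ Finset.Icc 1 K, ∀ h ∈ Finset.Icc 1 H, ∀ ω s, W t ω h s ∈ Set.Icc 0 R) :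
    μ {ω | (E + R) * √(k * H * y) < |∑ t ∈ Finset.Ico 1 (k + 1), ∑ h ∈ Finset.Icc 1 H,
        (e t ω ((X ω).state t h) ((X ω).action t h) + W t ω h ((X ω).state t (h + 1))
          - ∑ a, π t ω h ((X ω).state t h) a * (e t ω ((X ω).state t h) a
            + ∑ s', M.p ((X ω).state t h) a s' * W t ω h s'))|}
      ≤ ENNReal.ofReal (2 * (k * H) * Real.exp (-2 * y)) := by
  have hkK := Finset.mem_Icc.1 hk
  have hK : ∀ t ∈ Finset.Icc 1 k, t ∈ Finset.Icc 1 K := fun t ht => by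
    have := Finset.mem_Icc.1 ht
    exact Finset.mem_Icc.2 ⟨by omega, by omega⟩
  have hle : ∀ t ∈ Finset.Icc 1 K, ∀ h ∈ Finset.Icc 1 (H + 1), past t h ≤ m0 := hX.past_le
  have hh1 : ∀ h ∈ Finset.Icc 1 H, h ∈ Finset.Icc 1 (H + 1) := fun h hh => by
    have := Finset.mem_Icc.1 hh
    exact Finset.mem_Icc.2 ⟨by omega, by omega⟩
  have hh2 : ∀ h ∈ Finset.Icc 1 H, h + 1 ∈ Finset.Icc 1 (H + 1) := fun h hh => by
    have := Finset.mem_Icc.1 hh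
    exact Finset.mem_Icc.2 ⟨by omega, by omega⟩
  have hstart : ∀ t ∈ Finset.Icc 1 K, ∀ h ∈ Finset.Icc 1 H, past t 1 ≤ past t h :=
    fun t ht h hh => by
      have := Finset.mem_Icc.1 hh
      exact hX.past_le_past ht le_rfl (by omega) (by omega)
  set Z : ℕ → ℕ → Ω → ℝ := fun t h ω =>
    e t ω ((X ω).state t h) ((X ω).action t h) + W t ω h ((X ω).state t (h + 1)) with hZdef
  set Φ : ℕ → ℕ → A → Ω → ℝ := fun t h a ω => e t ω ((X ω).state t h) a
    + ∑ s', M.p ((X ω).state t h) a s' * W t ω h s' with hΦ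
  have hΦm : ∀ t ∈ Finset.Icc 1 K, ∀ h ∈ Finset.Icc 1 H, ∀ a,
      Measurable[past t h] (Φ t h a) := fun t ht h hh a =>
    measurable_eval_finite (F := fun s ω => e t ω s a + ∑ s', M.p s a s' * W t ω h s')
      (hX.state_meas t ht h (hh1 h hh)) fun s =>
      ((hem t ht s a).add (Finset.measurable_sum _ fun s' _ =>
        (hWm t ht h hh s').const_mul _)).mono (hstart t ht h hh) le_rfl
  have hΦb : ∀ t ∈ Finset.Icc 1 K, ∀ h ∈ Finset.Icc 1 H, ∀ a ω, |Φ t h a ω| ≤ E + R :=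
    fun t ht h hh a ω => by
      have h1 := heb t ht ω ((X ω).state t h) a
      have h2 := abs_sum_mul_le_of_sum_le_one hR (M.p_nonneg ((X ω).state t h) a)
        (M.p_sum ((X ω).state t h) a).le fun s' => by
          rw [abs_of_nonneg (hWb t ht h hh ω s').1]; exact (hWb t ht h hh ω s').2
      refine (abs_add_le _ _).trans (add_le_add ?_ h2)
      rw [abs_of_nonneg h1.1]
      exact h1.2
  have hesm : ∀ t ∈ Finset.Icc 1 K, ∀ h ∈ Finset.Icc 1 H,
      Measurable[pastAction past X t h]
        (fun ω => e t ω ((X ω).state t h) ((X ω).action t h)) := fun t ht h hh =>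
    measurable_eval_finite (F := fun a ω => e t ω ((X ω).state t h) a)
      (action_meas_pastAction past X t h) fun a =>
      measurable_eval_finite (F := fun s ω => e t ω s a) (hX.state_meas_pastAction ht hh)
        fun s => (hem t ht s a).mono ((hstart t ht h hh).trans le_sup_left) le_rfl
  have hZm : ∀ t ∈ Finset.Icc 1 K, ∀ h ∈ Finset.Icc 1 H,
      Measurable[past t (h + 1)] (Z t h) := fun t ht h hh =>
    ((hesm t ht h hh).mono (hX.pastAction_le_past_succ ht hh) le_rfl).add
      (measurable_eval_finite (F := fun s ω => W t ω h s) (hX.state_meas_succ ht hh) fun s =>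
        (hWm t ht h hh s).mono ((hstart t ht h hh).trans (hX.past_step t ht h hh)) le_rfl)
  have hZb : ∀ t ∈ Finset.Icc 1 K, ∀ h ∈ Finset.Icc 1 H, ∀ ω, Z t h ω ∈ Set.Icc 0 (E + R) :=
    fun t ht h hh ω => by
      have h1 := heb t ht ω ((X ω).state t h) ((X ω).action t h)
      have h2 := hWb t ht h hh ω ((X ω).state t (h + 1))
      exact ⟨add_nonneg h1.1 h2.1, add_le_add h1.2 h2.2⟩
  have hmean1 : ∀ t ∈ Finset.Icc 1 K, ∀ h ∈ Finset.Icc 1 H,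
      μ[Z t h | pastAction past X t h] =ᵐ[μ] fun ω => Φ t h ((X ω).action t h) ω :=
    fun t ht h hh => by
      have h1 := condExp_eval_finite (μ := μ) (C := E + R) (hX.pastAction_le ht hh)
        (Y := fun ω => (X ω).state t (h + 1))
        (F := fun s' ω => e t ω ((X ω).state t h) ((X ω).action t h) + W t ω h s')
        (fun s' => hle t ht (h + 1) (hh2 h hh) _ (hX.state_meas_succ ht hh s'))
        (fun s' => (hesm t ht h hh).add
          ((hWm t ht h hh s').mono ((hstart t ht h hh).trans le_sup_left) le_rfl))
        (fun s' => Filter.Eventually.of_forall fun ω => by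
          have h1 := heb t ht ω ((X ω).state t h) ((X ω).action t h)
          have h2 := hWb t ht h hh ω s'
          rw [abs_of_nonneg (add_nonneg h1.1 h2.1)]
          exact add_le_add h1.2 h2.2)
        (hX.next_law t ht h hh)
      refine h1.trans (Filter.Eventually.of_forall fun ω => ?_)
      simp only [hΦ, mul_add, Finset.sum_add_distrib, ← Finset.sum_mul, M.p_sum, one_mul]
  -- Tower property: the next state is averaged given the action, then the action is averaged under
  -- the policy.
  have hmean : ∀ t ∈ Finset.Icc 1 K, ∀ h ∈ Finset.Icc 1 H, μ[Z t h | past t h] =ᵐ[μ]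
      fun ω => ∑ a, π t ω h ((X ω).state t h) a * Φ t h a ω := fun t ht h hh => by
    have h1 := condExp_eval_finite (μ := μ) (C := E + R) (hle t ht h (hh1 h hh))
      (Y := fun ω => (X ω).action t h) (F := Φ t h)
      (fun a => hle t ht (h + 1) (hh2 h hh) _ (hX.action_meas t ht h hh a)) (hΦm t ht h hh)
      (fun a => Filter.Eventually.of_forall (hΦb t ht h hh a)) (hX.action_law t ht h hh)
    have h2 := condExp_condExp_of_le (μ := μ) (f := Z t h)
      (le_sup_left : past t h ≤ pastAction past X t h) (hX.pastAction_le ht hh)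
    exact h2.symm.trans ((condExp_congr_ae (hmean1 t ht h hh)).trans h1)
  -- Every step is active here, so the count is the constant `k * H`.
  have key := measure_episodic_deviation_le (μ := μ) (F := past) (k := k)
    (Z := Z) (q := fun t h ω => ∑ a, π t ω h ((X ω).state t h) a * Φ t h a ω)
    (w := fun _ _ _ => 1) hH (add_pos_of_pos_of_nonneg hE hR)
    (fun t ht h hh => hle t (hK t ht) h (hh1 h hh))
    (fun t ht h hh => hX.past_step t (hK t ht) h (Finset.Ico_subset_Icc_self hh))
    (fun t ht => (hX.past_step t (hK t (Finset.Ico_subset_Icc_self ht)) H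
      (Finset.mem_Icc.2 ⟨hH, le_rfl⟩)).trans (hX.past_episode t (Finset.mem_Ico.2
        ⟨(Finset.mem_Ico.1 ht).1, by have := (Finset.mem_Ico.1 ht).2; omega⟩)))
    (fun t ht h hh => ((hZm t (hK t ht) h hh).mono (hle t (hK t ht) (h + 1) (hh2 h hh))
      le_rfl).aestronglyMeasurable)
    (fun t ht h hh => (hZm t (hK t ht) h (Finset.Ico_subset_Icc_self hh)).aestronglyMeasurable)
    (fun t ht => ((hZm t (hK t (Finset.Ico_subset_Icc_self ht)) H
      (Finset.mem_Icc.2 ⟨hH, le_rfl⟩)).mono (hX.past_episode t (Finset.mem_Ico.2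
        ⟨(Finset.mem_Ico.1 ht).1, by have := (Finset.mem_Ico.1 ht).2; omega⟩))
      le_rfl).aestronglyMeasurable)
    (fun t ht h hh => Filter.Eventually.of_forall (hZb t (hK t ht) h hh))
    (fun t ht h hh => hmean t (hK t ht) h hh)
    (fun t ht h hh => aestronglyMeasurable_const)
    (fun t ht h hh => Filter.Eventually.of_forall fun ω => Or.inl rfl)
    hy
  have hcount : ∑ t ∈ Finset.Ico 1 (k + 1), ∑ h ∈ Finset.Icc 1 H, (1 : ℝ) = k * H := by simp
  have hpos : (0 : ℝ) < k * H := by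
    have : 0 < k := hkK.1
    positivity
  simp only [hcount, hpos, true_and] at key
  exact key

end IsInteraction

end Interaction

/-! ### The good event and its probability -/

section GoodEvents

variable {S A D : Type*}

/-- The mean reward (`none`) or the mean consumption of a resource (`some i`). -/
def CMDP.objective [Fintype S] (M : CMDP S A D) : Option D → S → A → ℝ
  | none => M.r
  | some i => fun s a => M.c s a i

/-- The observed reward (`none`) or the observed consumption of a resource (`some i`). -/
def Record.signal (x : Record S A D) : Option D → ℕ → ℕ → ℝ
  | none => x.reward
  | some i => fun t h => x.cons t h i

theorem CMDP.objective_mem [Fintype S] (M : CMDP S A D) (j : Option D) (s : S) (a : A) :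
    M.objective j s a ∈ Set.Icc (0 : ℝ) 1 := by
  cases j with
  | none => exact M.r_mem s a
  | some i => exact M.c_mem s a i

/-- The logarithm in the bonus of episode `k`. -/
def logFactor (nS nA H d : ℕ) (δ : ℝ) (k : ℕ) : ℝ :=
  Real.log (8 * (nS : ℝ) * (nA : ℝ) * (H : ℝ) * ((d : ℝ) + 1) * (k : ℝ) ^ 2 / δ)

theorem one_le_scale {nS nA H : ℕ} (hS : 0 < nS) (hA : 0 < nA) (hH : 0 < H) (d : ℕ) :
    (1 : ℝ) ≤ nS * nA * H * ((d : ℝ) + 1) := by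
  have : 1 ≤ nS * nA * H * (d + 1) := Nat.succ_le_of_lt (by positivity)
  exact_mod_cast this

theorem eight_le_logFactor_arg {nS nA H d k : ℕ} {δ : ℝ} (hS : 0 < nS) (hA : 0 < nA) (hH : 0 < H)
    (hk : 0 < k) (hδ : 0 < δ) (hδ1 : δ ≤ 1) :
    8 ≤ 8 * (nS : ℝ) * (nA : ℝ) * (H : ℝ) * ((d : ℝ) + 1) * (k : ℝ) ^ 2 / δ := by
  have h1 := one_le_scale hS hA hH d
  have h2 : (1 : ℝ) ≤ (k : ℝ) ^ 2 := one_le_pow₀ (by exact_mod_cast hk)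
  rw [le_div_iff₀ hδ]
  have h3 := one_le_mul_of_one_le_of_one_le h1 h2
  linarith

theorem one_le_logFactor {nS nA H d k : ℕ} {δ : ℝ} (hS : 0 < nS) (hA : 0 < nA) (hH : 0 < H)
    (hk : 0 < k) (hδ : 0 < δ) (hδ1 : δ ≤ 1) : 1 ≤ logFactor nS nA H d δ k := by
  have h8 := eight_le_logFactor_arg (d := d) hS hA hH hk hδ hδ1
  rw [logFactor, Real.le_log_iff_exp_le (by linarith)]
  linarith [Real.exp_one_lt_d9]

theorem logFactor_mono {nS nA H d t k : ℕ} {δ : ℝ} (hS : 0 < nS) (hA : 0 < nA) (hH : 0 < H)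
    (ht : 0 < t) (htk : t ≤ k) (hδ : 0 < δ) (hδ1 : δ ≤ 1) :
    logFactor nS nA H d δ t ≤ logFactor nS nA H d δ k := by
  refine Real.log_le_log (by linarith [eight_le_logFactor_arg (d := d) hS hA hH ht hδ hδ1]) ?_
  gcongr

/-- The failure probability of one episode is summable with sum at most `δ`. -/
theorem failure_bound {nS nA H d k : ℕ} {δ : ℝ} (hS : 0 < nS) (hA : 0 < nA) (hH : 0 < H)
    (hk : 0 < k) (hδ : 0 < δ) (hδ1 : δ ≤ 1) :
    6 * ((nS : ℝ) * nA * H * ((d : ℝ) + 1)) * (k * H)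
      * Real.exp (-2 * logFactor nS nA H d δ k) ≤ δ / (k * (k + 1)) := by
  have h8 := eight_le_logFactor_arg (d := d) hS hA hH hk hδ hδ1
  -- The factor 2 squares the argument of the logarithm. The resulting k⁻⁴ and Q⁻² absorb the size
  -- of the union bound and leave a summable failure probability.
  have hexp : Real.exp (-2 * logFactor nS nA H d δ k)
      = ((8 * (nS : ℝ) * (nA : ℝ) * (H : ℝ) * ((d : ℝ) + 1) * (k : ℝ) ^ 2 / δ) ^ 2)⁻¹ := by
    rw [logFactor, neg_mul, Real.exp_neg, mul_comm, Real.exp_mul, Real.exp_log (by linarith)]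
    norm_num
  rw [hexp]
  set Q : ℝ := (nS : ℝ) * nA * H * ((d : ℝ) + 1) with hQ
  have hHQ : (H : ℝ) ≤ Q := by
    have : H ≤ nS * nA * H * (d + 1) := by
      calc H = 1 * 1 * H * 1 := by ring
        _ ≤ _ := by gcongr <;> omega
    rw [hQ]; exact_mod_cast this
  have hH0 : (0 : ℝ) < H := by exact_mod_cast hH
  have hQ0 : 0 < Q := hH0.trans_le hHQ
  have hk1 : (1 : ℝ) ≤ k := by exact_mod_cast hk
  have e : 8 * (nS : ℝ) * (nA : ℝ) * (H : ℝ) * ((d : ℝ) + 1) * (k : ℝ) ^ 2 / δ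
      = 8 * Q * (k : ℝ) ^ 2 / δ := by rw [hQ]; ring
  rw [e, div_pow, inv_div, ← mul_div_assoc, div_le_div_iff₀ (by positivity) (by positivity)]
  have h1 : Q * H ≤ Q ^ 2 := by nlinarith
  have h2 : (k : ℝ) * (k * (k + 1)) ≤ 2 * k ^ 4 := by
    have : (k : ℝ) ≤ k ^ 2 := by nlinarith
    nlinarith [sq_nonneg ((k : ℝ))]
  have h3 : δ ^ 2 ≤ δ := by nlinarith
  calc 6 * Q * (k * H) * δ ^ 2 * (k * (k + 1)) = 6 * (Q * H) * δ ^ 2 * (k * (k * (k + 1))) := by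
        ring
    _ ≤ 6 * Q ^ 2 * δ * (2 * k ^ 4) := by gcongr
    _ ≤ δ * (8 * Q * (k : ℝ) ^ 2) ^ 2 := by
        have : 0 ≤ δ * Q ^ 2 * (k : ℝ) ^ 4 := by positivity
        nlinarith

variable [Fintype S] [Fintype A] [Fintype D] [DecidableEq S] [DecidableEq A]

/-- Validity of the estimates used in episode `k`: Bellman errors along the benchmark's value
functions are dominated by the bonus, and the transition estimates are close in `ℓ¹`. -/
def EstimatesGood (M : CMDP S A D) (H : ℕ) (δ : ℝ) (πstar : ℕ → S → A → ℝ) (x : Record S A D)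
    (k : ℕ) : Prop :=
  (∀ s a j, ∀ h ∈ Finset.Icc 1 H,
    |empMean H x k (x.signal j) s a
        + ∑ s', pHat H x k s a s' * value πstar M.p (M.objective j) (H - h) (h + 1) s'
      - (M.objective j s a
        + ∑ s', M.p s a s' * value πstar M.p (M.objective j) (H - h) (h + 1) s')|
      ≤ bonus H δ x k s a) ∧
  ∀ s a, ∑ s', |pHat H x k s a s' - M.p s a s'|
    ≤ 2 * √((Fintype.card S + logFactor (Fintype.card S) (Fintype.card A) H (Fintype.card D) δ k)
        / visits H x k s a)

theorem sum_mul_mem_Icc {ι : Type*} [Fintype ι] {q x : ι → ℝ} {B : ℝ} (hB : 0 ≤ B)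
    (hq : ∀ i, 0 ≤ q i) (hq1 : ∑ i, q i ≤ 1) (h : ∀ i, x i ∈ Set.Icc 0 B) :
    ∑ i, q i * x i ∈ Set.Icc 0 B :=
  ⟨Finset.sum_nonneg fun i _ => mul_nonneg (hq i) (h i).1,
    sum_mul_le_of_sum_le_one hB hq hq1 fun i => (h i).2⟩

omit [Fintype D] [DecidableEq S] [DecidableEq A] in
-- At most H − 1 steps remain after step `h`, so adding a signal in [0, 1] stays within [0, H], the
-- range used for the bonus.
theorem value_mem_Icc {M : CMDP S A D} {H : ℕ} {π : ℕ → S → A → ℝ} (hπ : IsPolicy H π)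
    (j : Option D) {h : ℕ} (hh : h ∈ Finset.Icc 1 H) (s : S) :
    value π M.p (M.objective j) (H - h) (h + 1) s ∈ Set.Icc (0 : ℝ) (H - 1) := by
  have hh := Finset.mem_Icc.1 hh
  refine ⟨value_nonneg hπ M.isSubstochastic (fun s a => (M.objective_mem j s a).1) _ _ _
    (by omega) (by omega), ?_⟩
  have := abs_value_le zero_le_one hπ M.isSubstochastic (m := M.objective j) (fun s a => by
    rw [abs_of_nonneg (M.objective_mem j s a).1]; exact (M.objective_mem j s a).2)
    (H - h) (h + 1) s (by omega) (by omega)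
  refine (le_abs_self _).trans (this.trans ?_)
  rw [mul_one, Nat.cast_sub hh.2]
  have : (1 : ℝ) ≤ h := by exact_mod_cast hh.1
  linarith

/-- Visited pairs inherit the deviation bounds; for unvisited pairs the trivial ranges already lie
below the confidence widths because the logarithm is at least 1. -/
theorem estimatesGood_of_deviations {M : CMDP S A D} {H k : ℕ} (hH : 0 < H) {δ : ℝ}
    {πstar : ℕ → S → A → ℝ} (hπ : IsPolicy H πstar) {x : Record S A D}
    (hl : 1 ≤ logFactor (Fintype.card S) (Fintype.card A) H (Fintype.card D) δ k)
    (hx : ∀ j, ∀ t ∈ Finset.Ico 1 k, ∀ h ∈ Finset.Icc 1 H, x.signal j t h ∈ Set.Icc (0 : ℝ) 1)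
    (h1 : ∀ s a j, ∀ h ∈ Finset.Icc 1 H, 0 < visitCount H x k s a →
      |∑ t ∈ Finset.Ico 1 k, ∑ h' ∈ Finset.Icc 1 H,
        (if x.state t h' = s ∧ x.action t h' = a then x.signal j t h'
            + value πstar M.p (M.objective j) (H - h) (h + 1) (x.state t (h' + 1))
          - (M.objective j s a
            + ∑ s', M.p s a s' * value πstar M.p (M.objective j) (H - h) (h + 1) s') else 0)|
      ≤ H * √(visitCount H x k s a
        * (2 * logFactor (Fintype.card S) (Fintype.card A) H (Fintype.card D) δ k)))
    (h2 : ∀ s a (T : Finset S), 0 < visitCount H x k s a →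
      |∑ t ∈ Finset.Ico 1 k, ∑ h' ∈ Finset.Icc 1 H,
        (if x.state t h' = s ∧ x.action t h' = a then 0
            + (if x.state t (h' + 1) ∈ T then (1 : ℝ) else 0)
          - (0 + ∑ s', M.p s a s' * (if s' ∈ T then (1 : ℝ) else 0)) else 0)|
      ≤ 1 * √(visitCount H x k s a * (Fintype.card S
        + logFactor (Fintype.card S) (Fintype.card A) H (Fintype.card D) δ k))) :
    EstimatesGood M H δ πstar x k := by
  have hH1 : (1 : ℝ) ≤ H := by exact_mod_cast hH
  have hp := pHat_isSubstochastic H x k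
  have hvis0 : ∀ {s a}, visitCount H x k s a = 0 → visits H x k s a = 1 := fun h => by
    rw [visits_eq, h]; exact max_eq_left zero_le_one
  constructor
  · intro s a j h hh
    have hV := fun s' => value_mem_Icc (M := M) hπ j hh s'
    have hH0 : (0 : ℝ) ≤ H - 1 := by linarith
    have m1 := empMean_mem H x k s a zero_le_one (hx j)
    have m2 := sum_mul_mem_Icc hH0 (hp.1 s a) (hp.2 s a) hV
    have m3 := M.objective_mem j s a
    have m4 := sum_mul_mem_Icc hH0 (M.p_nonneg s a) (M.p_sum s a).le hV
    -- Estimate and target both lie in [0, 1 + (H − 1)].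
    have hcrude : |empMean H x k (x.signal j) s a
        + ∑ s', pHat H x k s a s' * value πstar M.p (M.objective j) (H - h) (h + 1) s'
      - (M.objective j s a
        + ∑ s', M.p s a s' * value πstar M.p (M.objective j) (H - h) (h + 1) s')| ≤ H :=
      abs_le.2 ⟨by linarith [m1.1, m2.1, m3.2, m4.2], by linarith [m1.2, m2.2, m3.1, m4.1]⟩
    refine le_min (by linarith) ?_
    rcases (visitCount_nonneg H x k s a).eq_or_lt with h0 | h0
    · rw [hvis0 h0.symm, div_one]
      refine hcrude.trans (le_mul_of_one_le_right (by linarith) (Real.one_le_sqrt.2 ?_))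
      change 1 ≤ 2 * logFactor (Fintype.card S) (Fintype.card A) H (Fintype.card D) δ k
      linarith
    · exact abs_estimate_sub_le h0 (h1 s a j h hh h0)
  · intro s a
    refine sum_abs_le_of_subset_sums fun T => ?_
    have hT : ∀ p : S → A → S → ℝ, ∑ s' ∈ T, p s a s'
        = ∑ s', p s a s' * (if s' ∈ T then (1 : ℝ) else 0) := fun p => by simp
    rw [Finset.sum_sub_distrib, hT, hT]
    rcases (visitCount_nonneg H x k s a).eq_or_lt with h0 | h0
    · have e : ∑ s', pHat H x k s a s' * (if s' ∈ T then (1 : ℝ) else 0) = 0 := by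
        rw [sum_pHat_mul, empMean_eq_zero h0.symm]
      have m := sum_mul_mem_Icc zero_le_one (M.p_nonneg s a) (M.p_sum s a).le
        (x := fun s' => if s' ∈ T then (1 : ℝ) else 0) fun s' => by split_ifs <;> simp
      rw [e, zero_sub, abs_neg, abs_of_nonneg m.1, hvis0 h0.symm, div_one]
      refine m.2.trans (Real.one_le_sqrt.2 ?_)
      have : (0 : ℝ) ≤ Fintype.card S := Nat.cast_nonneg _
      linarith
    · have := abs_estimate_sub_le (y := fun _ _ => 0)
        (φ := fun s' => if s' ∈ T then (1 : ℝ) else 0) h0 (h2 s a T h0)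
      have e : empMean H x k (fun _ _ => 0) s a = 0 := by simp [empMean]
      rwa [e, zero_add, zero_add, one_mul] at this

variable {Ω : Type*} [m0 : MeasurableSpace Ω] {μ : Measure Ω} {M : CMDP S A D} {H K : ℕ} {s₀ : S}
  {past : ℕ → ℕ → MeasurableSpace Ω} {π : ℕ → Ω → ℕ → S → A → ℝ} {X : Ω → Record S A D}
  [IsProbabilityMeasure μ]

/-- Union bound over S A (d+1) H scalar deviations and S A 2^S subset deviations. Each family costs
at most 2 Q (k H) exp(−2l), with Q = S A H (d+1), hence the 4. -/
theorem measure_not_estimatesGood_le (hX : IsInteraction μ M H K s₀ past π X) (hH : 0 < H)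
    (hA : 0 < Fintype.card A) {δ : ℝ} (hδ : 0 < δ) (hδ1 : δ ≤ 1) {πstar : ℕ → S → A → ℝ}
    (hπ : IsPolicy H πstar) {k : ℕ} (hk : k ∈ Finset.Icc 1 K) :
    μ {ω | ¬ EstimatesGood M H δ πstar (X ω) k}
      ≤ ENNReal.ofReal (4 * ((Fintype.card S : ℝ) * Fintype.card A * H * ((Fintype.card D : ℝ) + 1))
        * (k * H)
        * Real.exp (-2 * logFactor (Fintype.card S) (Fintype.card A) H (Fintype.card D) δ k)) := by
  have hS : 0 < Fintype.card S := Fintype.card_pos_iff.2 ⟨s₀⟩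
  have hk' := Finset.mem_Icc.1 hk
  have hl := one_le_logFactor (d := Fintype.card D) hS hA hH hk'.1 hδ hδ1
  set l := logFactor (Fintype.card S) (Fintype.card A) H (Fintype.card D) δ k with hldef
  have hH0 : (0 : ℝ) < H := by exact_mod_cast hH
  have hsig : ∀ j, ∀ t ∈ Finset.Icc 1 K, ∀ h ∈ Finset.Icc 1 H,
      ∀ᵐ ω ∂μ, (X ω).signal j t h ∈ Set.Icc (0 : ℝ) 1 := by
    intro j t ht h hh
    cases j with
    | none => exact hX.reward_mem t ht h hh
    | some i => exact hX.cons_mem t ht h hh i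
  set E₁ : ((S × A) × Option D) × ℕ → Set Ω := fun q =>
    {ω | 0 < visitCount H (X ω) k q.1.1.1 q.1.1.2 ∧
      H * √(visitCount H (X ω) k q.1.1.1 q.1.1.2 * (2 * l))
        < |∑ t ∈ Finset.Ico 1 k, ∑ h' ∈ Finset.Icc 1 H,
          (if (X ω).state t h' = q.1.1.1 ∧ (X ω).action t h' = q.1.1.2 then (X ω).signal q.1.2 t h'
              + value πstar M.p (M.objective q.1.2) (H - q.2) (q.2 + 1) ((X ω).state t (h' + 1))
            - (M.objective q.1.2 q.1.1.1 q.1.1.2 + ∑ s', M.p q.1.1.1 q.1.1.2 s'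
              * value πstar M.p (M.objective q.1.2) (H - q.2) (q.2 + 1) s') else 0)|} with hE₁
  set E₂ : (S × A) × Finset S → Set Ω := fun q =>
    {ω | 0 < visitCount H (X ω) k q.1.1 q.1.2 ∧
      1 * √(visitCount H (X ω) k q.1.1 q.1.2 * (Fintype.card S + l))
        < |∑ t ∈ Finset.Ico 1 k, ∑ h' ∈ Finset.Icc 1 H,
          (if (X ω).state t h' = q.1.1 ∧ (X ω).action t h' = q.1.2 then 0
              + (if (X ω).state t (h' + 1) ∈ q.2 then (1 : ℝ) else 0)
            - (0 + ∑ s', M.p q.1.1 q.1.2 s' * (if s' ∈ q.2 then (1 : ℝ) else 0)) else 0)|} with hE₂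
  have hall : ∀ᵐ ω ∂μ, ∀ j, ∀ t ∈ Finset.Icc 1 K, ∀ h ∈ Finset.Icc 1 H,
      (X ω).signal j t h ∈ Set.Icc (0 : ℝ) 1 := by
    rw [Filter.eventually_all]
    intro j
    rw [Finset.eventually_all]
    intro t ht
    rw [Finset.eventually_all]
    exact fun h hh => hsig j t ht h hh
  have hsub : {ω | ¬ EstimatesGood M H δ πstar (X ω) k} ≤ᵐ[μ]
      ((⋃ q ∈ (Finset.univ : Finset ((S × A) × Option D)) ×ˢ Finset.Icc 1 H, E₁ q) ∪ ⋃ q, E₂ q :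
        Set Ω) := by
    filter_upwards [hall] with ω hω hbad
    by_contra hnot
    have hnot1 : ω ∉ ⋃ q ∈ (Finset.univ : Finset ((S × A) × Option D)) ×ˢ Finset.Icc 1 H, E₁ q :=
      fun h => hnot (Or.inl h)
    have hnot2 : ω ∉ ⋃ q, E₂ q := fun h => hnot (Or.inr h)
    refine hbad (estimatesGood_of_deviations hH hπ hl
      (fun j t ht h hh => hω j t (Finset.mem_Icc.2 ⟨(Finset.mem_Ico.1 ht).1, by
        have := (Finset.mem_Ico.1 ht).2; omega⟩) h hh) ?_ ?_)
    · intro s a j h hh hpos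
      by_contra hlt
      exact hnot1 (Set.mem_iUnion₂.2 ⟨(((s, a), j), h),
        Finset.mem_product.2 ⟨Finset.mem_univ _, hh⟩, hpos, not_le.1 hlt⟩)
    · intro s a T hpos
      by_contra hlt
      exact hnot2 (Set.mem_iUnion.2 ⟨((s, a), T), hpos, not_le.1 hlt⟩)
  have hm₁ : ∀ q ∈ (Finset.univ : Finset ((S × A) × Option D)) ×ˢ Finset.Icc 1 H,
      μ (E₁ q) ≤ ENNReal.ofReal (2 * (k * H) * Real.exp (-2 * l)) := by
    rintro ⟨⟨⟨s, a⟩, j⟩, h⟩ hq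
    have hh := (Finset.mem_product.1 hq).2
    refine (hX.measure_visit_deviation_le hH hk s a (Y := fun t h' ω => (X ω).signal j t h')
      (m := M.objective j) (φ := fun s' => value πstar M.p (M.objective j) (H - h) (h + 1) s')
      (B := H) (y := 2 * l) hH0 (by linarith) ?_ ?_ ?_).trans (ENNReal.ofReal_le_ofReal ?_)
    · intro t ht h' hh'
      cases j with
      | none => exact hX.reward_meas t ht h' hh'
      | some i => exact hX.cons_meas t ht h' hh' i
    · intro t ht h' hh'
      cases j with
      | none => exact hX.reward_mean t ht h' hh'
      | some i => exact hX.cons_mean t ht h' hh' i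
    · intro t ht h' hh'
      filter_upwards [hsig j t ht h' hh'] with ω hω s'
      have := value_mem_Icc (M := M) hπ j hh s'
      exact ⟨add_nonneg hω.1 this.1, by linarith [hω.2, this.2]⟩
    -- Deviation level 2l gives exp(−4l), more than is needed.
    · gcongr ?_ * Real.exp ?_
      linarith
  have hm₂ : ∀ q, μ (E₂ q)
      ≤ ENNReal.ofReal (2 * (k * H) * Real.exp (-2 * (Fintype.card S + l))) := by
    rintro ⟨⟨s, a⟩, T⟩
    have hpm : ∀ t ∈ Finset.Icc 1 K, ∀ h ∈ Finset.Icc 1 H,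
        μ[(fun _ : Ω => (0 : ℝ)) | pastAction past X t h] =ᵐ[μ] fun _ => 0 := fun t ht h hh => by
      rw [condExp_const (hX.pastAction_le ht hh)]
    exact hX.measure_visit_deviation_le hH hk s a (Y := fun _ _ _ => 0)
      (m := fun _ _ => 0) (φ := fun s' => if s' ∈ T then (1 : ℝ) else 0)
      (B := 1) (y := Fintype.card S + l) one_pos (by positivity)
      (fun _ _ _ _ => measurable_const) hpm
      (fun t ht h hh => Filter.Eventually.of_forall fun ω s' => by
        split_ifs <;> simp)
  have hsum₁ : μ (⋃ q ∈ (Finset.univ : Finset ((S × A) × Option D)) ×ˢ Finset.Icc 1 H, E₁ q)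
      ≤ ENNReal.ofReal (2 * ((Fintype.card S : ℝ) * Fintype.card A * H
        * ((Fintype.card D : ℝ) + 1)) * (k * H) * Real.exp (-2 * l)) := by
    refine (measure_biUnion_finset_le _ _).trans ((Finset.sum_le_sum hm₁).trans (le_of_eq ?_))
    rw [Finset.sum_const, nsmul_eq_mul, ← ENNReal.ofReal_natCast,
      ← ENNReal.ofReal_mul (by positivity)]
    congr 1
    simp only [Finset.card_product, Finset.card_univ, Fintype.card_prod, Fintype.card_option,
      Nat.card_Icc, Nat.add_sub_cancel]
    push_cast
    ring
  have hsum₂ : μ (⋃ q, E₂ q)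
      ≤ ENNReal.ofReal (2 * ((Fintype.card S : ℝ) * Fintype.card A * H
        * ((Fintype.card D : ℝ) + 1)) * (k * H) * Real.exp (-2 * l)) := by
    refine (measure_iUnion_fintype_le _ _).trans
      ((Finset.sum_le_sum fun q _ => hm₂ q).trans ?_)
    rw [Finset.sum_const, nsmul_eq_mul, ← ENNReal.ofReal_natCast,
      ← ENNReal.ofReal_mul (by positivity)]
    refine ENNReal.ofReal_le_ofReal ?_
    simp only [Finset.card_univ, Fintype.card_prod, Fintype.card_finset]
    push_cast
    -- The extra |S| in the ℓ¹ deviation level pays for the 2^|S| subsets.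
    have hpow : (2 : ℝ) ^ Fintype.card S * Real.exp (-2 * (Fintype.card S : ℝ)) ≤ 1 := by
      have h2 : (2 : ℝ) ≤ Real.exp 2 := by linarith [Real.add_one_le_exp (2 : ℝ)]
      have : Real.exp (-2 * (Fintype.card S : ℝ)) = (Real.exp 2 ^ Fintype.card S)⁻¹ := by
        rw [← Real.exp_nat_mul, ← Real.exp_neg]; ring_nf
      rw [this, ← div_eq_mul_inv]
      exact div_le_one_of_le₀ (pow_le_pow_left₀ (by norm_num) h2 _) (by positivity)
    have hHd : (1 : ℝ) ≤ H * ((Fintype.card D : ℝ) + 1) := by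
      have : 1 ≤ H * (Fintype.card D + 1) := Nat.succ_le_of_lt (by positivity)
      exact_mod_cast this
    rw [mul_add, Real.exp_add]
    calc (Fintype.card S : ℝ) * Fintype.card A * 2 ^ Fintype.card S
          * (2 * (k * H) * (Real.exp (-2 * (Fintype.card S : ℝ)) * Real.exp (-2 * l)))
        = 2 * ((Fintype.card S : ℝ) * Fintype.card A) * (k * H) * Real.exp (-2 * l)
          * (2 ^ Fintype.card S * Real.exp (-2 * (Fintype.card S : ℝ))) := by ring
      _ ≤ 2 * ((Fintype.card S : ℝ) * Fintype.card A) * (k * H) * Real.exp (-2 * l)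
          * (H * ((Fintype.card D : ℝ) + 1)) := by
          refine mul_le_mul_of_nonneg_left (hpow.trans hHd) (by positivity)
      _ = _ := by ring
  refine (measure_mono_ae hsub).trans ((measure_union_le _ _).trans
    ((add_le_add hsum₁ hsum₂).trans (le_of_eq ?_)))
  rw [← ENNReal.ofReal_add (by positivity) (by positivity)]
  congr 1
  ring

end GoodEvents

/-! ### Error of the optimistic model -/

section Regret

variable {S A D : Type*} [Fintype S] [Fintype A] [Fintype D] [DecidableEq S] [DecidableEq A]

/-- Bound on the one-step error of the optimistic model at each state-action pair. -/
def errorBound (D : Type*) [Fintype D] (H : ℕ) (δ : ℝ) (x : Record S A D) (t : ℕ) (s : S)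
    (a : A) : ℝ :=
  min (14 * (H : ℝ) ^ 2) (17 * (H : ℝ) ^ 2 * √(Fintype.card S
    * logFactor (Fintype.card S) (Fintype.card A) H (Fintype.card D) δ t / visits H x t s a))

theorem errorBound_mem (H : ℕ) (δ : ℝ) (x : Record S A D) (t : ℕ) (s : S) (a : A) :
    errorBound D H δ x t s a ∈ Set.Icc 0 (14 * (H : ℝ) ^ 2) :=
  ⟨le_min (by positivity) (by positivity), min_le_left _ _⟩

/-- The cumulative clipped error at step `h` with `n` steps to go. -/
def errorValue (M : CMDP S A D) (H : ℕ) (δ : ℝ) (π : ℕ → S → A → ℝ) (x : Record S A D) (t : ℕ) :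
    ℕ → ℕ → S → ℝ :=
  clippedValue (6 * (H : ℝ) ^ 2) π M.p (errorBound D H δ x t)

variable {M : CMDP S A D} {H : ℕ} {δ : ℝ} {πstar : ℕ → S → A → ℝ} {x : Record S A D} {t : ℕ}

/-- At the last step `h = H` no value remains, so the good event reduces to concentration of the
signal itself; the width of the box adds a second bonus. -/
theorem EstimatesGood.abs_objective_sub_le (hH : 0 < H)
    (hgood : EstimatesGood M H δ πstar x t) {j : Option D} {r : S → A → ℝ}
    (hr : InRewardBox (empMean H x t (x.signal j)) (bonus H δ x t) r) (s : S) (a : A) :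
    |r s a - M.objective j s a| ≤ 2 * bonus H δ x t s a := by
  have h1 := hgood.1 s a j H (Finset.mem_Icc.2 ⟨hH, le_rfl⟩)
  simp only [Nat.sub_self, value, mul_zero, Finset.sum_const_zero, add_zero] at h1
  have h2 := hr s a
  have h1 := abs_le.1 h1
  exact abs_le.2 ⟨by linarith [h1.1, h2.1], by linarith [h1.2, h2.2]⟩

/-- Clipped simulation lemma under the true transitions. Box objectives are at most 4H + 1 ≤ 5H in
size, so optimistic values are at most 5H² and differ from true ones by at most 6H², the clipping
level. -/
theorem EstimatesGood.abs_expTotal_sub_le (hH : 0 < H)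
    (hl : 1 ≤ logFactor (Fintype.card S) (Fintype.card A) H (Fintype.card D) δ t)
    (hgood : EstimatesGood M H δ πstar x t) {π : ℕ → S → A → ℝ} (hπ : IsPolicy H π)
    {j : Option D} {r : S → A → ℝ}
    (hr : InRewardBox (empMean H x t (x.signal j)) (bonus H δ x t) r) (s₀ : S) :
    |expTotal H s₀ π (pHat H x t) r - expTotal H s₀ π M.p (M.objective j)|
      ≤ errorValue M H δ π x t H 1 s₀ := by
  have hS : 1 ≤ (Fintype.card S : ℝ) := by
    exact_mod_cast Nat.succ_le_of_lt (Fintype.card_pos_iff.2 ⟨s₀⟩)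
  have hH1 : (1 : ℝ) ≤ H := by exact_mod_cast hH
  have hHsq : (H : ℝ) ≤ (H : ℝ) ^ 2 := by nlinarith
  have hp := pHat_isSubstochastic H x t
  have hrM := hgood.abs_objective_sub_le hH hr
  have hb : ∀ s a, bonus H δ x t s a ≤ 2 * H := fun s a => min_le_left _ _
  have hrb : ∀ s a, |r s a| ≤ 5 * H := fun s a => by
    have h1 := abs_le.1 (hrM s a)
    have h2 := M.objective_mem j s a
    have h3 := hb s a
    exact abs_le.2 ⟨by linarith [h1.1, h2.1], by linarith [h1.2, h2.2]⟩
  have hval : ∀ n h s, 1 ≤ h → h + n ≤ H + 1 →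
      |value π (pHat H x t) r n h s| ≤ 5 * (H : ℝ) ^ 2 := fun n h s h1 h2 => by
    refine (abs_value_le (by positivity) hπ hp hrb n h s h1 h2).trans ?_
    have : (n : ℝ) ≤ H := by exact_mod_cast (by omega : n ≤ H)
    nlinarith
  have hvalM : ∀ n h s, 1 ≤ h → h + n ≤ H + 1 →
      |value π M.p (M.objective j) n h s| ≤ (H : ℝ) ^ 2 := fun n h s h1 h2 => by
    refine (abs_value_le zero_le_one hπ M.isSubstochastic (fun s a => by
      rw [abs_of_nonneg (M.objective_mem j s a).1]; exact (M.objective_mem j s a).2)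
      n h s h1 h2).trans ?_
    have : (n : ℝ) ≤ H := by exact_mod_cast (by omega : n ≤ H)
    linarith
  refine abs_value_sub_value_le_clippedValue hπ M.isSubstochastic ?_ ?_ H 1 s₀ le_rfl (by omega)
  · intro n h s h1 h2
    have e1 := abs_le.1 (hval n h s h1 h2.le)
    have e2 := abs_le.1 (hvalM n h s h1 h2.le)
    exact abs_le.2 ⟨by linarith [e1.1, e2.2], by linarith [e1.2, e2.1]⟩
  · intro n h h1 h2 s a
    set l := logFactor (Fintype.card S) (Fintype.card A) H (Fintype.card D) δ t with hldef
    set N := visits H x t s a with hN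
    have hNpos : 0 < N := visits_pos H x t s a
    have htrans : |∑ s', (pHat H x t s a s' - M.p s a s') * value π (pHat H x t) r n (h + 1) s'|
        ≤ (∑ s', |pHat H x t s a s' - M.p s a s'|) * (5 * (H : ℝ) ^ 2) := by
      rw [Finset.sum_mul]
      refine (Finset.abs_sum_le_sum_abs _ _).trans (Finset.sum_le_sum fun s' _ => ?_)
      rw [abs_mul]
      exact mul_le_mul_of_nonneg_left (hval _ _ _ (by omega) (by omega)) (abs_nonneg _)
    have hsplit : |r s a + ∑ s', pHat H x t s a s' * value π (pHat H x t) r n (h + 1) s'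
        - (M.objective j s a + ∑ s', M.p s a s' * value π (pHat H x t) r n (h + 1) s')|
        ≤ 2 * bonus H δ x t s a
          + (∑ s', |pHat H x t s a s' - M.p s a s'|) * (5 * (H : ℝ) ^ 2) := by
      refine le_trans (le_of_eq ?_) ((abs_add_le _ _).trans (add_le_add (hrM s a) htrans))
      simp only [sub_mul, Finset.sum_sub_distrib]
      congr 1
      ring
    refine hsplit.trans (le_min ?_ ?_)
    -- Crude bound: 2·2H for the bonus plus 2·5H² for the transitions gives at most 14H².
    · have h2 : ∑ s', |pHat H x t s a s' - M.p s a s'| ≤ 2 := by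
        calc _ ≤ ∑ s', (pHat H x t s a s' + M.p s a s') := by
              refine Finset.sum_le_sum fun s' _ => (abs_sub _ _).trans (le_of_eq ?_)
              rw [abs_of_nonneg (hp.1 s a s'), abs_of_nonneg (M.p_nonneg s a s')]
          _ ≤ 2 := by
              rw [Finset.sum_add_distrib]
              linarith [hp.2 s a, M.p_sum s a]
      have := hb s a
      nlinarith
    -- Fine bound: both `2 * l` and `S + l` are at most 2 S l, so the error is at most (2 + 10) √2
    -- H² z, and 12 √2 ≤ 17.
    · set z := √(Fintype.card S * l / N) with hz
      have hz0 : 0 ≤ z := Real.sqrt_nonneg _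
      have hlin : ∀ y : ℝ, y ≤ 2 * (Fintype.card S * l) → √(y / N) ≤ √2 * z := fun y hy => by
        rw [hz, ← Real.sqrt_mul (by norm_num), ← mul_div_assoc]
        gcongr
      have hSl : l ≤ Fintype.card S * l := le_mul_of_one_le_left (by linarith) hS
      have hSl' : (Fintype.card S : ℝ) ≤ Fintype.card S * l :=
        le_mul_of_one_le_right (by linarith) hl
      have hb2 : bonus H δ x t s a ≤ H * (√2 * z) :=
        (min_le_right _ _).trans (mul_le_mul_of_nonneg_left
          (hlin (2 * l) (by linarith)) (by positivity))
      have hp2 : ∑ s', |pHat H x t s a s' - M.p s a s'| ≤ 2 * (√2 * z) :=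
        (hgood.2 s a).trans (mul_le_mul_of_nonneg_left
          (hlin (Fintype.card S + l) (by linarith)) (by norm_num))
      have hs2 : √2 ≤ 17 / 12 := Real.sqrt_le_iff.2 ⟨by norm_num, by norm_num⟩
      have hs20 : 0 ≤ √2 * z := by positivity
      calc 2 * bonus H δ x t s a + (∑ s', |pHat H x t s a s' - M.p s a s'|) * (5 * (H : ℝ) ^ 2)
          ≤ 2 * ((H : ℝ) ^ 2 * (√2 * z)) + 2 * (√2 * z) * (5 * (H : ℝ) ^ 2) := by
            refine add_le_add (mul_le_mul_of_nonneg_left (hb2.trans ?_) (by norm_num))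
              (mul_le_mul_of_nonneg_right hp2 (by positivity))
            exact mul_le_mul_of_nonneg_right hHsq hs20
        _ = 12 * (H : ℝ) ^ 2 * z * √2 := by ring
        _ ≤ 12 * (H : ℝ) ^ 2 * z * (17 / 12) := by gcongr
        _ = 17 * (H : ℝ) ^ 2 * z := by ring

/-- The benchmark is feasible for the planner and matches its true objective in the box. -/
theorem EstimatesGood.exists_box (hgood : EstimatesGood M H δ πstar x t)
    (hπ : IsPolicy H πstar) (s₀ : S) (j : Option D) :
    ∃ r, InRewardBox (empMean H x t (x.signal j)) (bonus H δ x t) r ∧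
      expTotal H s₀ πstar (pHat H x t) r = expTotal H s₀ πstar M.p (M.objective j) := by
  refine exists_box_value_eq hπ (pHat_isSubstochastic H x t)
    (fun s a => le_min (by positivity) (by positivity)) ?_ s₀
  intro n h h1 h2 s a
  have hn : n = H - h := by omega
  subst hn
  rw [abs_sub_comm]
  exact hgood.1 s a j h (Finset.mem_Icc.2 ⟨h1, by omega⟩)

/-- One episode: the clipped error is at most the realized errors plus noise. -/
theorem errorValue_le_sum (π : ℕ → S → A → ℝ) (st : ℕ → S) :
    errorValue M H δ π x t H 1 (st 1) ≤ ∑ h ∈ Finset.Icc 1 H,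
      (∑ a, π h (st h) a * (errorBound D H δ x t (st h) a
          + ∑ s', M.p (st h) a s' * errorValue M H δ π x t (H - h) (h + 1) s')
        - errorValue M H δ π x t (H - h) (h + 1) (st (h + 1))) := by
  have main : ∀ j ≤ H, errorValue M H δ π x t H 1 (st 1) ≤ ∑ h ∈ Finset.Icc 1 j,
      (∑ a, π h (st h) a * (errorBound D H δ x t (st h) a
          + ∑ s', M.p (st h) a s' * errorValue M H δ π x t (H - h) (h + 1) s')
        - errorValue M H δ π x t (H - h) (h + 1) (st (h + 1)))
      + errorValue M H δ π x t (H - j) (j + 1) (st (j + 1)) := by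
    intro j
    induction j with
    | zero => intro _; simp
    | succ j ih =>
      intro hj
      refine (ih (by omega)).trans ?_
      rw [Finset.sum_Icc_succ_top (by omega)]
      -- Dropping the clip at the current step bounds it by its one-step expectation; the values at
      -- later states telescope.
      have : errorValue M H δ π x t (H - j) (j + 1) (st (j + 1))
          ≤ ∑ a, π (j + 1) (st (j + 1)) a * (errorBound D H δ x t (st (j + 1)) a
          + ∑ s', M.p (st (j + 1)) a s'
            * errorValue M H δ π x t (H - (j + 1)) (j + 1 + 1) s') := by
        rw [show H - j = H - (j + 1) + 1 by omega]
        exact min_le_right _ _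
      linarith
  refine (main H le_rfl).trans (le_of_eq ?_)
  rw [Nat.sub_self]
  exact add_zero _

/-- Logarithms of earlier episodes are dominated by that of episode `k`, which leaves the pigeonhole
sum. -/
theorem sum_errorBound_le (x : Record S A D) {k : ℕ} (hH : 0 < H) (hS : 0 < Fintype.card S)
    (hA : 0 < Fintype.card A) (hδ : 0 < δ) (hδ1 : δ ≤ 1) :
    ∑ t ∈ Finset.Ico 1 (k + 1), ∑ h ∈ Finset.Icc 1 H,
      errorBound D H δ x t (x.state t h) (x.action t h)
      ≤ 17 * (H : ℝ) ^ 2 * √(Fintype.card S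
          * logFactor (Fintype.card S) (Fintype.card A) H (Fintype.card D) δ k)
        * (2 * √2 * √(Fintype.card S * Fintype.card A * (k * H))
          + 2 * H * (Fintype.card S * Fintype.card A)) := by
  refine le_trans ?_ (mul_le_mul_of_nonneg_left (sum_inv_sqrt_visits_le H x k) (by positivity))
  rw [Finset.mul_sum]
  refine Finset.sum_le_sum fun t ht => ?_
  rw [Finset.mul_sum]
  refine Finset.sum_le_sum fun h hh => ?_
  have ht' := Finset.mem_Ico.1 ht
  refine (min_le_right _ _).trans ?_
  rw [mul_assoc (17 * (H : ℝ) ^ 2), mul_one_div]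
  have hl := logFactor_mono (d := Fintype.card D) hS hA hH ht'.1 (by omega : t ≤ k) hδ hδ1
  rw [Real.sqrt_div' _ (visits_pos H x t _ _).le]
  gcongr

end Regret

/-! ### From expected to realized model errors -/

section Trajectory

variable {S A D Ω : Type*} [Fintype S] [Fintype A] [Fintype D] [DecidableEq S] [DecidableEq A]
  [m0 : MeasurableSpace Ω] {μ : Measure Ω} {M : CMDP S A D} {H K : ℕ} {s₀ : S}
  {past : ℕ → ℕ → MeasurableSpace Ω} {π : ℕ → Ω → ℕ → S → A → ℝ} {X : Ω → Record S A D}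

theorem IsInteraction.errorBound_meas (hX : IsInteraction μ M H K s₀ past π X) (δ : ℝ) {t : ℕ}
    (ht : t ∈ Finset.Icc 1 K) (s : S) (a : A) :
    Measurable[past t 1] (fun ω => errorBound D H δ (X ω) t s a) :=
  Measurable.min measurable_const (Measurable.const_mul
    (Measurable.sqrt (Measurable.div measurable_const (hX.visits_meas ht s a))) _)

theorem IsInteraction.errorValue_meas (hX : IsInteraction μ M H K s₀ past π X) (δ : ℝ) {t : ℕ}
    (ht : t ∈ Finset.Icc 1 K) : ∀ (n h : ℕ) (s : S), 1 ≤ h → h + n ≤ H + 1 →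
      Measurable[past t 1] (fun ω => errorValue M H δ (π t ω) (X ω) t n h s)
  | 0, _, _, _, _ => measurable_const
  | n + 1, h, s, h1, h2 => by
    refine Measurable.min measurable_const (Finset.measurable_sum _ fun a _ =>
      (hX.policy_meas t ht h (Finset.mem_Icc.2 ⟨h1, by omega⟩) s a).mul
        ((hX.errorBound_meas δ ht s a).add (Finset.measurable_sum _ fun s' _ =>
          (hX.errorValue_meas δ ht n (h + 1) s' (by omega) (by omega)).const_mul _)))

/-- High-probability bound on the accumulated model errors of the first `k` episodes. -/
theorem IsInteraction.measure_sum_errorValue_le [IsProbabilityMeasure μ]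
    (hX : IsInteraction μ M H K s₀ past π X) (hH : 0 < H) {δ : ℝ} {k : ℕ}
    (hk : k ∈ Finset.Icc 1 K)
    (hl : 0 ≤ logFactor (Fintype.card S) (Fintype.card A) H (Fintype.card D) δ k) :
    μ {ω | ¬ ∑ t ∈ Finset.Ico 1 (k + 1), errorValue M H δ (π t ω) (X ω) t H 1 s₀
        ≤ ∑ t ∈ Finset.Ico 1 (k + 1), ∑ h ∈ Finset.Icc 1 H,
            errorBound D H δ (X ω) t ((X ω).state t h) ((X ω).action t h)
          + 20 * (H : ℝ) ^ 2 * √(k * H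
            * logFactor (Fintype.card S) (Fintype.card A) H (Fintype.card D) δ k)}
      ≤ ENNReal.ofReal (2 * (k * H)
        * Real.exp (-2 * logFactor (Fintype.card S) (Fintype.card A) H (Fintype.card D) δ k)) := by
  have hH0 : (0 : ℝ) < H := by exact_mod_cast hH
  refine le_trans (measure_mono ?_) (hX.measure_trajectory_deviation_le hH hk
    (e := fun t ω => errorBound D H δ (X ω) t)
    (W := fun t ω h s => errorValue M H δ (π t ω) (X ω) t (H - h) (h + 1) s)
    (E := 14 * (H : ℝ) ^ 2) (R := 6 * (H : ℝ) ^ 2) (by positivity) (by positivity) hl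
    (fun t ht s a => hX.errorBound_meas δ ht s a) (fun t ht ω s a => errorBound_mem H δ _ t s a)
    (fun t ht h hh s => ?_) (fun t ht h hh ω s => ?_))
  · intro ω hω
    by_contra hnot
    refine hω ?_
    simp only [Set.mem_ofPred_eq, not_lt] at hnot
    -- Only one tail is used: conditional means exceed realized errors plus next values by at most
    -- the noise, of increment range 14H² + 6H² = 20H².
    have hdev := (neg_le_abs _).trans hnot
    have hinit : ∀ t ∈ Finset.Ico 1 (k + 1), (X ω).state t 1 = s₀ := fun t ht => by
      have h1 := Finset.mem_Ico.1 ht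
      have h2 := Finset.mem_Icc.1 hk
      exact hX.init t (Finset.mem_Icc.2 ⟨by omega, by omega⟩) ω
    have hep := fun t (ht : t ∈ Finset.Ico 1 (k + 1)) =>
      (congrArg (errorValue M H δ (π t ω) (X ω) t H 1) (hinit t ht)).symm.le.trans
        (errorValue_le_sum (π t ω) ((X ω).state t))
    refine (Finset.sum_le_sum hep).trans ?_
    simp only [Finset.sum_sub_distrib, Finset.sum_add_distrib] at hdev ⊢
    linarith
  · have := Finset.mem_Icc.1 hh
    exact hX.errorValue_meas δ ht _ _ s (by omega) (by omega)
  · have := Finset.mem_Icc.1 hh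
    exact clippedValue_mem (by positivity) (hX.policy t ht ω) M.isSubstochastic
      (fun s a => (errorBound_mem H δ _ t s a).1) _ _ s (by omega) (by omega)

end Trajectory

/-! ### Comparison with the basic bound -/

section Arithmetic

variable {nS nA H d k : ℕ} {δ : ℝ}

theorem le_scaled_arg (hS : 0 < nS) (hA : 0 < nA) (hH : 0 < H) (d k : ℕ) (hδ : 0 < δ)
    (hδ1 : δ ≤ 1) : (k : ℝ) ≤ (nS : ℝ) * nA * H * ((d : ℝ) + 1) * k / δ := by
  have h1 := one_le_scale hS hA hH d
  have hk : (0 : ℝ) ≤ k := Nat.cast_nonneg k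
  rw [le_div_iff₀ hδ]
  calc (k : ℝ) * δ ≤ k * 1 := mul_le_mul_of_nonneg_left hδ1 hk
    _ = 1 * k := by ring
    _ ≤ _ := mul_le_mul_of_nonneg_right h1 hk

theorem logFactor_arg_le (hS : 0 < nS) (hA : 0 < nA) (hH : 0 < H) (d k : ℕ) (hδ : 0 < δ)
    (hδ1 : δ ≤ 1) :
    8 * (nS : ℝ) * (nA : ℝ) * (H : ℝ) * ((d : ℝ) + 1) * (k : ℝ) ^ 2 / δ
      ≤ 8 * ((nS : ℝ) * nA * H * ((d : ℝ) + 1) * k / δ) ^ 2 := by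
  have h := le_scaled_arg hS hA hH d k hδ hδ1
  have hz : 0 ≤ (nS : ℝ) * nA * H * ((d : ℝ) + 1) * k / δ := by positivity
  calc _ = 8 * (((nS : ℝ) * nA * H * ((d : ℝ) + 1) * k / δ) * k) := by ring
    _ ≤ _ := by
      rw [sq]
      gcongr

/-- With z = Q k / δ ≥ 1 for Q = S A H (d+1), the argument of the logarithm is at most 8z² ≤ (2z)⁵.
-/
theorem logFactor_le_five_mul (hS : 0 < nS) (hA : 0 < nA) (hH : 0 < H) (d : ℕ) (hk : 0 < k)
    (hδ : 0 < δ) (hδ1 : δ ≤ 1) :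
    logFactor nS nA H d δ k
      ≤ 5 * Real.log (2 * (nS : ℝ) * nA * H * ((d : ℝ) + 1) * k / δ) := by
  have h := le_scaled_arg hS hA hH d k hδ hδ1
  have hk1 : (1 : ℝ) ≤ k := by exact_mod_cast hk
  have e : 2 * (nS : ℝ) * nA * H * ((d : ℝ) + 1) * k / δ
      = 2 * ((nS : ℝ) * nA * H * ((d : ℝ) + 1) * k / δ) := by ring
  rw [e, logFactor]
  have harg := logFactor_arg_le hS hA hH d k hδ hδ1
  set z := (nS : ℝ) * nA * H * ((d : ℝ) + 1) * k / δ
  have hz : 1 ≤ z := hk1.trans h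
  have h5 : (5 : ℝ) * Real.log (2 * z) = Real.log ((2 * z) ^ 5) := by
    rw [Real.log_pow]; norm_num
  rw [h5]
  refine Real.log_le_log (by linarith [eight_le_logFactor_arg (d := d) hS hA hH hk hδ hδ1])
    (harg.trans ?_)
  have : (1 : ℝ) ≤ z ^ 3 := one_le_pow₀ hz
  nlinarith [sq_nonneg z]

/-- For k ≥ 2 also z ≥ 2, so 8z² ≤ z⁵, and log k ≥ 1/2 inserts the factor log k. This fails at k =
1, where log k = 0. -/
theorem logFactor_le_ten_mul (hS : 0 < nS) (hA : 0 < nA) (hH : 0 < H) (d : ℕ) (hk : 2 ≤ k)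
    (hδ : 0 < δ) (hδ1 : δ ≤ 1) :
    logFactor nS nA H d δ k
      ≤ 10 * (Real.log k * Real.log ((nS : ℝ) * nA * H * ((d : ℝ) + 1) * k / δ)) := by
  have h := le_scaled_arg hS hA hH d k hδ hδ1
  have hk2 : (2 : ℝ) ≤ k := by exact_mod_cast hk
  have harg := logFactor_arg_le hS hA hH d k hδ hδ1
  rw [logFactor]
  set z := (nS : ℝ) * nA * H * ((d : ℝ) + 1) * k / δ
  have hz : 2 ≤ z := hk2.trans h
  have hlogk : 1 / 2 ≤ Real.log k :=
    (by linarith [Real.log_two_gt_d9] : (1 : ℝ) / 2 ≤ Real.log 2).trans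
      (Real.log_le_log (by norm_num) hk2)
  have hlogz : 0 ≤ Real.log z := Real.log_nonneg (by linarith)
  have h5 : Real.log (8 * (nS : ℝ) * (nA : ℝ) * (H : ℝ) * ((d : ℝ) + 1) * (k : ℝ) ^ 2 / δ)
      ≤ 5 * Real.log z := by
    have e : (5 : ℝ) * Real.log z = Real.log (z ^ 5) := by
      rw [Real.log_pow]; norm_num
    rw [e]
    refine Real.log_le_log
      (by linarith [eight_le_logFactor_arg (d := d) hS hA hH (by omega : 0 < k) hδ hδ1])
      (harg.trans ?_)
    have : (2 : ℝ) ^ 3 ≤ z ^ 3 := pow_le_pow_left₀ (by norm_num) hz 3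
    nlinarith [sq_nonneg z]
  nlinarith

theorem rpow_half_eq {x : ℝ} (hx : 0 ≤ x) (n : ℕ) : x ^ ((n : ℝ) / 2) = √x ^ n := by
  rw [Real.sqrt_eq_rpow, ← Real.rpow_natCast, ← Real.rpow_mul hx]
  ring_nf

/-- The accumulated error divided by the number of episodes is within the basic bound. -/
theorem average_error_le_basicBound (hS : 0 < nS) (hA : 0 < nA) (hH : 0 < H) (d : ℕ) (hk : 0 < k)
    (hδ : 0 < δ) (hδ1 : δ ≤ 1) :
    1 / (k : ℝ) * (17 * (H : ℝ) ^ 2 * √(nS * logFactor nS nA H d δ k)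
        * (2 * √2 * √(nS * nA * (k * H)) + 2 * H * (nS * nA))
      + 20 * (H : ℝ) ^ 2 * √(k * H * logFactor nS nA H d δ k))
      ≤ basicBound 400 nS nA H d k δ := by
  have hk0 : (0 : ℝ) < k := by exact_mod_cast hk
  have hone : ∀ {n : ℕ}, 0 < n → 1 ≤ √(n : ℝ) := fun hn =>
    Real.one_le_sqrt.2 (by exact_mod_cast hn)
  have hsq : ∀ n : ℕ, √(n : ℝ) ^ 2 = n := fun n => Real.sq_sqrt (Nat.cast_nonneg n)
  have hH5 : (H : ℝ) ^ (5 / 2 : ℝ) = √(H : ℝ) ^ 5 := by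
    have := rpow_half_eq (Nat.cast_nonneg H : (0 : ℝ) ≤ H) 5
    exact_mod_cast this
  have hS3 : (nS : ℝ) ^ (3 / 2 : ℝ) = √(nS : ℝ) ^ 3 := by
    have := rpow_half_eq (Nat.cast_nonneg nS : (0 : ℝ) ≤ nS) 3
    exact_mod_cast this
  have h5 := logFactor_le_five_mul hS hA hH d hk hδ hδ1
  have h10 := fun h2 : 2 ≤ k => logFactor_le_ten_mul hS hA hH d h2 hδ hδ1
  have hl0 := one_le_logFactor (d := d) hS hA hH hk hδ hδ1
  rw [basicBound, hH5, hS3]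
  set l := logFactor nS nA H d δ k
  set L₁ := Real.log k * Real.log ((nS : ℝ) * nA * H * ((d : ℝ) + 1) * k / δ)
  set L₂ := Real.log (2 * (nS : ℝ) * nA * H * ((d : ℝ) + 1) * k / δ)
  -- (9/4)² ≥ 5; below, 4² ≥ 10.
  have hl5 : √l ≤ 9 / 4 * √L₂ := by
    calc √l ≤ √((9 / 4) ^ 2 * L₂) := Real.sqrt_le_sqrt (by linarith)
      _ = 9 / 4 * √L₂ := by
        rw [Real.sqrt_mul (by norm_num), Real.sqrt_sq (by norm_num)]
  have hl10 : 2 ≤ k → √l ≤ 4 * √L₁ := fun h2 => by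
    have hh := h10 h2
    calc √l ≤ √(4 ^ 2 * L₁) := Real.sqrt_le_sqrt (by linarith)
      _ = 4 * √L₁ := by
        rw [Real.sqrt_mul (by norm_num), Real.sqrt_sq (by norm_num)]
  have hs2 : √2 ≤ 3 / 2 := Real.sqrt_le_iff.2 ⟨by norm_num, by norm_num⟩
  have e1 : √((nS : ℝ) * l) = √nS * √l := Real.sqrt_mul (Nat.cast_nonneg _) _
  have e2 : √((nS : ℝ) * nA * (k * H)) = √nS * √nA * (√k * √H) := by
    rw [Real.sqrt_mul (by positivity), Real.sqrt_mul (Nat.cast_nonneg _),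
      Real.sqrt_mul (Nat.cast_nonneg _)]
  have e3 : √((k : ℝ) * H * l) = √k * √H * √l := by
    rw [Real.sqrt_mul (by positivity), Real.sqrt_mul (Nat.cast_nonneg _)]
  rw [e1, e2, e3]
  have ek : 400 / √(k : ℝ) = 1 / k * (400 * √k) := by
    have := hone hk
    rw [← hsq k, Real.sqrt_sq (Real.sqrt_nonneg _)]
    field_simp
  have ek' : (400 : ℝ) / k = 1 / k * 400 := by ring
  rw [ek, ek']
  rw [← hsq nS, ← hsq nA, ← hsq H]
  simp only [Real.sqrt_sq (Real.sqrt_nonneg _)]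
  have hs := hone hS
  have ha := hone hA
  have hη := hone hH
  have hκ := hone hk
  set s := √(nS : ℝ)
  set a := √(nA : ℝ)
  set η := √(H : ℝ)
  set lam := √l
  have hlam : 0 ≤ lam := Real.sqrt_nonneg _
  -- With √2 ≤ 3/2 the constants are 17·2·(3/2) + 20 = 71, the noise being absorbed into the leading
  -- term, and 17·2 = 34.
  have hmain : 17 * (η ^ 2) ^ 2 * (s * lam) * (2 * √2 * (s * a * (√k * η))
        + 2 * η ^ 2 * (s ^ 2 * a ^ 2)) + 20 * (η ^ 2) ^ 2 * (√k * η * lam)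
      ≤ 71 * (√k * (η ^ 5 * s ^ 2 * a)) * lam + 34 * (s ^ 3 * a ^ 2 * η ^ 6) * lam := by
    have h1 : √k * η ^ 5 * lam ≤ √k * η ^ 5 * lam * (s ^ 2 * a) :=
      le_mul_of_one_le_right (by positivity)
        (one_le_mul_of_one_le_of_one_le (one_le_pow₀ hs) ha)
    have h2 : √k * (η ^ 5 * s ^ 2 * a) * lam * √2 ≤ √k * (η ^ 5 * s ^ 2 * a) * lam * (3 / 2) :=
      mul_le_mul_of_nonneg_left hs2 (by positivity)
    nlinarith
  have hfirst : 0 ≤ √k * (η ^ 5 * s ^ 2 * a) := by positivity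
  have hsecond : 0 ≤ s ^ 3 * a ^ 2 * η ^ 6 := by positivity
  have hgoal : 71 * (√k * (η ^ 5 * s ^ 2 * a)) * lam + 34 * (s ^ 3 * a ^ 2 * η ^ 6) * lam
      ≤ 400 * √k * (η ^ 5 * s ^ 2 * a) * √L₁ + 400 * (s ^ 3 * a ^ 2 * (η ^ 2) ^ 3) * √L₂ := by
    have hL₁ : 0 ≤ √L₁ := Real.sqrt_nonneg _
    have hL₂ : 0 ≤ √L₂ := Real.sqrt_nonneg _
    have h2 := mul_le_mul_of_nonneg_left hl5 hsecond
    have hL2' := mul_nonneg hsecond hL₂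
    have hL1' := mul_nonneg hfirst hL₁
    have e6 : (η ^ 2) ^ 3 = η ^ 6 := by ring
    rw [e6]
    -- At k = 1 the leading term of the bound vanishes and the second one carries everything: (71 +
    -- 34)·9/4 ≤ 400. For k ≥ 2, 71·4 ≤ 400 and 34·9/4 ≤ 400.
    rcases (by omega : k = 1 ∨ 2 ≤ k) with h | h
    · have hκ1 : √(k : ℝ) = 1 := by rw [h]; simp
      have h3 : √(k : ℝ) * (η ^ 5 * s ^ 2 * a) ≤ s ^ 3 * a ^ 2 * η ^ 6 := by
        rw [hκ1, one_mul]
        calc η ^ 5 * s ^ 2 * a ≤ η ^ 5 * s ^ 2 * a * (s * a * η) :=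
              le_mul_of_one_le_right (by positivity)
                (one_le_mul_of_one_le_of_one_le (one_le_mul_of_one_le_of_one_le hs ha) hη)
          _ = _ := by ring
      have h4 := mul_le_mul_of_nonneg_right h3 hlam
      linarith
    · have h3 := mul_le_mul_of_nonneg_left (hl10 h) hfirst
      linarith
  calc _ ≤ 1 / (k : ℝ) * (400 * √k * (η ^ 5 * s ^ 2 * a) * √L₁
        + 400 * (s ^ 3 * a ^ 2 * (η ^ 2) ^ 3) * √L₂) := by
        exact mul_le_mul_of_nonneg_left (hmain.trans hgoal) (by positivity)
    _ = _ := by ring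

theorem sum_inv_mul_succ_le (K : ℕ) : ∑ k ∈ Finset.Icc 1 K, 1 / ((k : ℝ) * (k + 1)) ≤ 1 := by
  have : ∑ k ∈ Finset.Icc 1 K, 1 / ((k : ℝ) * (k + 1)) = 1 - 1 / ((K : ℝ) + 1) := by
    induction K with
    | zero => simp
    | succ K ih =>
      rw [Finset.sum_Icc_succ_top (by omega), ih]
      push_cast
      field_simp
      ring
  rw [this]
  have : (0 : ℝ) ≤ 1 / ((K : ℝ) + 1) := by positivity
  linarith

end Arithmetic

/-! ### Jensen and Lipschitz averaging -/

section Averages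

/-- Jensen puts `f` at the averaged optimistic values above `v`; Lipschitz continuity moves to the
true averages. -/
theorem sub_concave_average_le {f : ℝ → ℝ} {L : ℝ} (hf : ConcaveOn ℝ Set.univ f)
    (hLip : ∀ x y, |f x - f y| ≤ L * |x - y|) {k : ℕ} (hk : 0 < k) {v B : ℝ} {y z : ℕ → ℝ}
    (hv : ∀ t ∈ Finset.Icc 1 k, v ≤ f (y t))
    (hB : 1 / (k : ℝ) * ∑ t ∈ Finset.Icc 1 k, |y t - z t| ≤ B) :
    v - f ((1 / (k : ℝ)) * ∑ t ∈ Finset.Icc 1 k, z t) ≤ L * B := by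
  have hL : 0 ≤ L := by simpa using (abs_nonneg _).trans (hLip 1 0)
  have hk0 : (0 : ℝ) < k := by exact_mod_cast hk
  have hw : ∑ _t ∈ Finset.Icc 1 k, 1 / (k : ℝ) = 1 := by
    simp [hk0.ne']
  have h1 := hf.le_map_sum (t := Finset.Icc 1 k) (w := fun _ => 1 / (k : ℝ)) (p := y)
    (fun _ _ => by positivity) hw fun _ _ => Set.mem_univ _
  simp only [smul_eq_mul, ← Finset.mul_sum] at h1
  have h2 : v ≤ 1 / (k : ℝ) * ∑ t ∈ Finset.Icc 1 k, f (y t) := by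
    calc v = ∑ _t ∈ Finset.Icc 1 k, 1 / (k : ℝ) * v := by rw [← Finset.sum_mul, hw, one_mul]
      _ ≤ ∑ t ∈ Finset.Icc 1 k, 1 / (k : ℝ) * f (y t) :=
        Finset.sum_le_sum fun t ht => mul_le_mul_of_nonneg_left (hv t ht) (by positivity)
      _ = _ := by rw [Finset.mul_sum]
  have h3 := (le_abs_self _).trans
    (hLip (1 / (k : ℝ) * ∑ t ∈ Finset.Icc 1 k, y t) (1 / (k : ℝ) * ∑ t ∈ Finset.Icc 1 k, z t))
  have h4 : |1 / (k : ℝ) * ∑ t ∈ Finset.Icc 1 k, y t - 1 / (k : ℝ) * ∑ t ∈ Finset.Icc 1 k, z t|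
      ≤ B := by
    rw [← mul_sub, ← Finset.sum_sub_distrib, abs_mul, abs_of_nonneg (by positivity)]
    exact (mul_le_mul_of_nonneg_left (Finset.abs_sum_le_sum_abs _ _) (by positivity)).trans hB
  have h5 := mul_le_mul_of_nonneg_left h4 hL
  linarith

/-- Same argument, with the ℓ¹ norm summing one `B` per resource. Nonnegativity of `L` is assumed
separately because without resources the Lipschitz condition says nothing about `L`. -/
theorem convex_average_le {D : Type*} [Fintype D] {g : (D → ℝ) → ℝ} {L : ℝ}
    (hg : ConvexOn ℝ Set.univ g) (hL : 0 ≤ L)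
    (hLip : ∀ x y, |g x - g y| ≤ L * ∑ i, |x i - y i|) {k : ℕ} (hk : 0 < k) {B : ℝ}
    {y z : ℕ → D → ℝ} (hy : ∀ t ∈ Finset.Icc 1 k, g (y t) ≤ 0)
    (hB : ∀ i, 1 / (k : ℝ) * ∑ t ∈ Finset.Icc 1 k, |y t i - z t i| ≤ B) :
    g ((1 / (k : ℝ)) • ∑ t ∈ Finset.Icc 1 k, z t) ≤ L * (Fintype.card D : ℝ) * B := by
  have hk0 : (0 : ℝ) < k := by exact_mod_cast hk
  have hw : ∑ _t ∈ Finset.Icc 1 k, 1 / (k : ℝ) = 1 := by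
    simp [hk0.ne']
  have h1 := hg.map_sum_le (t := Finset.Icc 1 k) (w := fun _ => 1 / (k : ℝ)) (p := y)
    (fun _ _ => by positivity) hw fun _ _ => Set.mem_univ _
  simp only [← Finset.smul_sum] at h1
  have h2 : (1 / (k : ℝ)) • ∑ t ∈ Finset.Icc 1 k, g (y t) ≤ 0 :=
    mul_nonpos_of_nonneg_of_nonpos (by positivity) (Finset.sum_nonpos hy)
  have h3 := (le_abs_self _).trans
    (hLip ((1 / (k : ℝ)) • ∑ t ∈ Finset.Icc 1 k, z t) ((1 / (k : ℝ)) • ∑ t ∈ Finset.Icc 1 k, y t))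
  have h4 : ∑ i, |((1 / (k : ℝ)) • ∑ t ∈ Finset.Icc 1 k, z t) i
      - ((1 / (k : ℝ)) • ∑ t ∈ Finset.Icc 1 k, y t) i| ≤ Fintype.card D * B := by
    calc _ ≤ ∑ _i : D, B := by
          refine Finset.sum_le_sum fun i _ => le_trans ?_ (hB i)
          rw [Pi.smul_apply, Pi.smul_apply, Finset.sum_apply, Finset.sum_apply, smul_eq_mul,
            smul_eq_mul, abs_sub_comm, ← mul_sub, ← Finset.sum_sub_distrib, abs_mul,
            abs_of_nonneg (by positivity)]
          exact mul_le_mul_of_nonneg_left (Finset.abs_sum_le_sum_abs _ _) (by positivity)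
      _ = _ := by simp
  have h5 := mul_le_mul_of_nonneg_left h4 hL
  linarith

end Averages

/-! ### Optimism and the regret bound -/

section Main

variable {S A D : Type*} [Fintype S] [Fintype A] [Fintype D] [DecidableEq S] [DecidableEq A]

/-- On the good event, the planner's policy comes with near-correct optimistic rewards and
feasible consumptions. -/
theorem EstimatesGood.planner {M : CMDP S A D} {H : ℕ} (hH : 0 < H) {δ : ℝ}
    {πstar : ℕ → S → A → ℝ} {x : Record S A D} {t : ℕ} {s₀ : S} {f : ℝ → ℝ} {g : (D → ℝ) → ℝ}
    (hl : 1 ≤ logFactor (Fintype.card S) (Fintype.card A) H (Fintype.card D) δ t)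
    (hgood : EstimatesGood M H δ πstar x t) (hstar : IsBenchmark M H s₀ f g πstar)
    {π : ℕ → S → A → ℝ}
    (hplan : (∃ π', PlannerFeasible H s₀ g (pHat H x t) (cHat H x t) (bonus H δ x t) π') →
      PlannerSolution H s₀ f g (pHat H x t) (rHat H x t) (cHat H x t) (bonus H δ x t) π) :
    ∃ (v : ℝ) (u : D → ℝ), f (expTotal H s₀ πstar M.p M.r) ≤ f v ∧ g u ≤ 0 ∧
      |v - expTotal H s₀ π M.p M.r| ≤ errorValue M H δ π x t H 1 s₀ ∧
      ∀ i, |u i - expTotalVec H s₀ π M.p M.c i| ≤ errorValue M H δ π x t H 1 s₀ := by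
  obtain ⟨r', hr', hr'eq⟩ := hgood.exists_box hstar.1 s₀ none
  -- The consumption box is a product over resources, so each resource can be matched on its own.
  choose c' hc' hc'eq using fun i => hgood.exists_box hstar.1 s₀ (some i)
  have hfeas : PlannerFeasible H s₀ g (pHat H x t) (cHat H x t) (bonus H δ x t) πstar := by
    refine ⟨hstar.1, fun s a i => c' i s a, fun s a i => hc' i s a, ?_⟩
    have e : expTotalVec H s₀ πstar (pHat H x t) (fun s a i => c' i s a)
        = expTotalVec H s₀ πstar M.p M.c := funext fun i => hc'eq i
    rw [e]
    exact hstar.2.1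
  obtain ⟨⟨hπ, c, hc, hgc⟩, r, hr, hopt⟩ := hplan ⟨πstar, hfeas⟩
  refine ⟨expTotal H s₀ π (pHat H x t) r, expTotalVec H s₀ π (pHat H x t) c, ?_, hgc, ?_, ?_⟩
  · have := hopt πstar hfeas r' hr'
    rwa [hr'eq] at this
  · exact hgood.abs_expTotal_sub_le hH hl hπ (j := none) hr s₀
  · exact fun i => hgood.abs_expTotal_sub_le hH hl hπ (j := some i)
      (r := fun s a => c s a i) (fun s a => hc s a i) s₀

/-- The deterministic core: it needs valid estimates in all episodes up to `k` but the trajectory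
bound only at `k`. -/
theorem regret_le_of_good {M : CMDP S A D} {H : ℕ} (hH : 0 < H) (hA : 0 < Fintype.card A) {δ : ℝ}
    (hδ : 0 < δ) (hδ1 : δ ≤ 1) {πstar : ℕ → S → A → ℝ} {x : Record S A D} {k : ℕ} (hk : 0 < k)
    {s₀ : S} {f : ℝ → ℝ} {g : (D → ℝ) → ℝ} {L : ℝ} (hf : ConcaveOn ℝ Set.univ f)
    (hg : ConvexOn ℝ Set.univ g) (hfL : ∀ x y, |f x - f y| ≤ L * |x - y|)
    (hgL : ∀ x y, |g x - g y| ≤ L * ∑ i, |x i - y i|) (hstar : IsBenchmark M H s₀ f g πstar)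
    {π : ℕ → ℕ → S → A → ℝ} (hgood : ∀ t ∈ Finset.Icc 1 k, EstimatesGood M H δ πstar x t)
    (hplan : ∀ t ∈ Finset.Icc 1 k,
      (∃ π', PlannerFeasible H s₀ g (pHat H x t) (cHat H x t) (bonus H δ x t) π') →
      PlannerSolution H s₀ f g (pHat H x t) (rHat H x t) (cHat H x t) (bonus H δ x t) (π t))
    (htraj : ∑ t ∈ Finset.Ico 1 (k + 1), errorValue M H δ (π t) x t H 1 s₀
        ≤ ∑ t ∈ Finset.Ico 1 (k + 1), ∑ h ∈ Finset.Icc 1 H,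
            errorBound D H δ x t (x.state t h) (x.action t h)
          + 20 * (H : ℝ) ^ 2 * √(k * H
            * logFactor (Fintype.card S) (Fintype.card A) H (Fintype.card D) δ k)) :
    convexRewReg M H s₀ f πstar π k
        ≤ L * basicBound 400 (Fintype.card S) (Fintype.card A) H (Fintype.card D) k δ ∧
      convexConsReg M H s₀ g π k ≤ L * (Fintype.card D : ℝ)
        * basicBound 400 (Fintype.card S) (Fintype.card A) H (Fintype.card D) k δ := by
  have hS : 0 < Fintype.card S := Fintype.card_pos_iff.2 ⟨s₀⟩
  have hL : 0 ≤ L := by simpa using (abs_nonneg _).trans (hfL 1 0)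
  -- Stated for all `t`, with value 0 outside the range, so that choice gives plain sequences.
  have hP : ∀ t, ∃ (v : ℝ) (u : D → ℝ), t ∈ Finset.Icc 1 k →
      f (expTotal H s₀ πstar M.p M.r) ≤ f v ∧ g u ≤ 0 ∧
      |v - expTotal H s₀ (π t) M.p M.r| ≤ errorValue M H δ (π t) x t H 1 s₀ ∧
      ∀ i, |u i - expTotalVec H s₀ (π t) M.p M.c i| ≤ errorValue M H δ (π t) x t H 1 s₀ := by
    intro t
    by_cases ht : t ∈ Finset.Icc 1 k
    · obtain ⟨v, u, h⟩ := (hgood t ht).planner hH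
        (one_le_logFactor hS hA hH (Finset.mem_Icc.1 ht).1 hδ hδ1) hstar (hplan t ht)
      exact ⟨v, u, fun _ => h⟩
    · exact ⟨0, 0, fun h => absurd h ht⟩
  choose v u hvu using hP
  have hIcc : Finset.Ico 1 (k + 1) = Finset.Icc 1 k := Finset.Ico_add_one_right_eq_Icc 1 k
  have herr := sum_errorBound_le (D := D) (H := H) (k := k) x hH hS hA hδ hδ1
  have htot : 1 / (k : ℝ) * ∑ t ∈ Finset.Icc 1 k, errorValue M H δ (π t) x t H 1 s₀
      ≤ basicBound 400 (Fintype.card S) (Fintype.card A) H (Fintype.card D) k δ := by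
    refine le_trans (mul_le_mul_of_nonneg_left ?_ (by positivity))
      (average_error_le_basicBound hS hA hH (Fintype.card D) hk hδ hδ1)
    rw [← hIcc]
    exact htraj.trans (by linarith)
  constructor
  · refine sub_concave_average_le hf hfL hk (y := v) (fun t ht => (hvu t ht).1)
      (le_trans (mul_le_mul_of_nonneg_left ?_ (by positivity)) htot)
    exact Finset.sum_le_sum fun t ht => (hvu t ht).2.2.1
  · refine convex_average_le hg hL hgL hk (y := u) (fun t ht => (hvu t ht).2.1) fun i =>
      le_trans (mul_le_mul_of_nonneg_left ?_ (by positivity)) htot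
    exact Finset.sum_le_sum fun t ht => (hvu t ht).2.2.2 i

end Main

end ConRL

end

theorem theorem2 :
    ∃ C : ℝ, 0 < C ∧
      ∀ (S A D Ω : Type*) [Fintype S] [Fintype A] [Fintype D] [DecidableEq S] [DecidableEq A]
        [MeasurableSpace Ω] (μ : MeasureTheory.Measure Ω) [MeasureTheory.IsProbabilityMeasure μ]
        (M : ConRL.CMDP S A D) (H K : ℕ) (_ : 0 < H) (s₀ : S)
        (f : ℝ → ℝ) (g : (D → ℝ) → ℝ) (L : ℝ)
        (_ : ConcaveOn ℝ Set.univ f) (_ : ConvexOn ℝ Set.univ g)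
        (_ : ∀ x y, |f x - f y| ≤ L * |x - y|)
        (_ : ∀ x y, |g x - g y| ≤ L * ∑ i, |x i - y i|)
        (πstar : ℕ → S → A → ℝ) (_ : ConRL.IsBenchmark M H s₀ f g πstar)
        (δ : ℝ) (_ : 0 < δ) (_ : δ < 1)
        (past : ℕ → ℕ → MeasurableSpace Ω) (π : ℕ → Ω → ℕ → S → A → ℝ)
        (X : Ω → ConRL.Record S A D)
        (_ : ConRL.IsInteraction μ M H K s₀ past π X)
        (_ : ConRL.RunsConvexConRL μ H K s₀ δ f g π X),
        μ {ω | ¬ ∀ k ∈ Finset.Icc 1 K,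
            ConRL.convexRewReg M H s₀ f πstar (fun t => π t ω) k
              ≤ L * ConRL.basicBound C (Fintype.card S) (Fintype.card A) H (Fintype.card D) k δ ∧
            ConRL.convexConsReg M H s₀ g (fun t => π t ω) k
              ≤ L * (Fintype.card D : ℝ)
                * ConRL.basicBound C (Fintype.card S) (Fintype.card A) H (Fintype.card D) k δ}
          ≤ ENNReal.ofReal δ := by
  refine ⟨400, by norm_num, ?_⟩
  intro S A D Ω _ _ _ _ _ _ μ _ M H K hH s₀ f g L hf hg hfL hgL πstar hstar δ hδ hδ1 past π X
    hX hrun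
  have hS : 0 < Fintype.card S := Fintype.card_pos_iff.2 ⟨s₀⟩
  -- The benchmark's action probabilities sum to 1, which excludes an empty action set.
  have hA : 0 < Fintype.card A := by
    refine Fintype.card_pos_iff.2 (not_isEmpty_iff.1 fun hempty => ?_)
    have := (hstar.1 1 (Finset.mem_Icc.2 ⟨le_rfl, hH⟩) s₀).2
    simp at this
  set Bad : ℕ → Set Ω := fun k => {ω | ¬ ConRL.EstimatesGood M H δ πstar (X ω) k} ∪
    {ω | ¬ ∑ t ∈ Finset.Ico 1 (k + 1), ConRL.errorValue M H δ (π t ω) (X ω) t H 1 s₀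
        ≤ ∑ t ∈ Finset.Ico 1 (k + 1), ∑ h ∈ Finset.Icc 1 H,
            ConRL.errorBound D H δ (X ω) t ((X ω).state t h) ((X ω).action t h)
          + 20 * (H : ℝ) ^ 2 * √(k * H
            * ConRL.logFactor (Fintype.card S) (Fintype.card A) H (Fintype.card D) δ k)}
    with hBad
  have hBadle : ∀ k ∈ Finset.Icc 1 K, μ (Bad k) ≤ ENNReal.ofReal (δ / (k * (k + 1))) := by
    intro k hk
    have hk1 := (Finset.mem_Icc.1 hk).1
    have hl := ConRL.one_le_logFactor (d := Fintype.card D) hS hA hH hk1 hδ hδ1.le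
    refine (measure_union_le _ _).trans ((add_le_add
      (ConRL.measure_not_estimatesGood_le hX hH hA hδ hδ1.le hstar.1 hk)
      (hX.measure_sum_errorValue_le hH hk (by linarith))).trans ?_)
    rw [← ENNReal.ofReal_add (by positivity) (by positivity)]
    refine ENNReal.ofReal_le_ofReal (le_trans ?_
      (ConRL.failure_bound (d := Fintype.card D) hS hA hH hk1 hδ hδ1.le))
    -- The coefficients 4Q and 2 combine to at most 6Q because Q ≥ 1.
    have h1 := ConRL.one_le_scale hS hA hH (Fintype.card D)
    set Q := (Fintype.card S : ℝ) * Fintype.card A * H * ((Fintype.card D : ℝ) + 1)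
    have h2 : 0 ≤ (k : ℝ) * H * Real.exp
        (-2 * ConRL.logFactor (Fintype.card S) (Fintype.card A) H (Fintype.card D) δ k) := by
      positivity
    nlinarith
  have hplan : ∀ᵐ ω ∂μ, ∀ k ∈ Finset.Icc 1 K,
      (∃ π', ConRL.PlannerFeasible H s₀ g (ConRL.pHat H (X ω) k) (ConRL.cHat H (X ω) k)
        (ConRL.bonus H δ (X ω) k) π') →
      ConRL.PlannerSolution H s₀ f g (ConRL.pHat H (X ω) k) (ConRL.rHat H (X ω) k)
        (ConRL.cHat H (X ω) k) (ConRL.bonus H δ (X ω) k) (π k ω) := by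
    rw [Finset.eventually_all]
    exact hrun
  calc _ ≤ μ (⋃ k ∈ Finset.Icc 1 K, Bad k) := by
        -- Inclusion holds only almost surely, since the planner is only required to be optimal
        -- almost surely.
        refine measure_mono_ae ?_
        filter_upwards [hplan] with ω hω hbad
        by_contra hnot
        have hgood : ∀ k ∈ Finset.Icc 1 K, ω ∉ Bad k := fun k hk h =>
          hnot (Set.mem_iUnion₂.2 ⟨k, hk, h⟩)
        refine hbad fun k hk => ?_
        have hk' := Finset.mem_Icc.1 hk
        have hsub : ∀ t ∈ Finset.Icc 1 k, t ∈ Finset.Icc 1 K := fun t ht =>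
          Finset.Icc_subset_Icc_right hk'.2 ht
        refine ConRL.regret_le_of_good hH hA hδ hδ1.le hk'.1 hf hg hfL hgL hstar
          (π := fun t => π t ω) (x := X ω)
          (fun t ht => ?_) (fun t ht => hω t (hsub t ht)) ?_
        · by_contra h
          exact hgood t (hsub t ht) (Or.inl h)
        · by_contra h
          exact hgood k hk (Or.inr h)
    _ ≤ ∑ k ∈ Finset.Icc 1 K, ENNReal.ofReal (δ / (k * (k + 1))) :=
        (measure_biUnion_finset_le _ _).trans (Finset.sum_le_sum hBadle)
    _ = ENNReal.ofReal (∑ k ∈ Finset.Icc 1 K, δ / ((k : ℝ) * (k + 1))) :=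
        (ENNReal.ofReal_sum_of_nonneg fun k _ => by positivity).symm
    _ ≤ ENNReal.ofReal δ := by
        refine ENNReal.ofReal_le_ofReal ?_
        calc ∑ k ∈ Finset.Icc 1 K, δ / ((k : ℝ) * (k + 1))
            = δ * ∑ k ∈ Finset.Icc 1 K, 1 / ((k : ℝ) * (k + 1)) := by
              rw [Finset.mul_sum]
              exact Finset.sum_congr rfl fun k _ => by ring
          _ ≤ δ * 1 := mul_le_mul_of_nonneg_left (ConRL.sum_inv_mul_succ_le K) hδ.le
          _ = δ := mul_one δ
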